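/- **Setting.** There are $n$ items, of which a set $\mathcal K$ of size $k$, uniformly random among all $\binom nk$ subsets of that size, is defective. In Bernoulli nonadaptive group testing with $T$ tests and parameter $p\in[0,1]$, each item is placed in each test independently with probability $p$; a test is positive if it contains at least one defective item and negative otherwise. A detection algorithm (possibly randomized, possibly knowing $n,k,T$) maps the design and the outcomes to an estimate $\hat{\mathcal K}$. Its average error probability is $\binom nk^{-1}\sum_{|\mathcal K|=k}\mathbb P(\hat{\mathcal K}\ne\mathcal K)$. For $k=k(n)$, the algorithm achieves the rate $R\in\mathbb R$ along $k$ if for every $\epsilon>0$ and all sufficiently large $n$ there are $p\in[0,1]$ and $T\ge1$ with $\log_2\binom n{k(n)}/T>R$ and average error probability less than $\epsilon$. For $\theta\in(0,1)$, $R$ is achievable if it is achieved along every $k(n)=\Theta(n^\theta)$; $R^*_{\mathtt A}$ is the supremum of the achievable rates of the algorithm $\mathtt A$, and the capacity is the supremum of $R^*_{\mathtt A}$ over all detection algorithms $\mathtt A$. **Algorithms.** A set $\mathcal L$ of items is *satisfying* if no negative test contains an item of $\mathcal L$ and every positive test contains an item of $\mathcal L$. The *possible defectives* are the items that are in no negative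 test. DD outputs the set of those possible defectives that are the only possible defective in some test. SCOMP starts with $\hat{\mathcal K}$ equal to the DD output; as long as some positive test contains no item of $\hat{\mathcal K}$ (is unexplained), it adds to $\hat{\mathcal K}$ a possible defective outside $\hat{\mathcal K}$ that lies in the most unexplained tests, ties being broken arbitrarily (possibly at random); it outputs the final $\hat{\mathcal K}$. **Theorem.** Let $\theta\in(0,1)$ and let SCOMP be implemented with any rule for breaking ties. 1. Whenever DD outputs a satisfying set, SCOMP outputs the same set. 2. SCOMP achieves every rate that DD achieves, both along each fixed $k(n)=\Theta(n^\theta)$ and along all of them, and $$R^*_{\mathrm{SCOMP}}\ \ge\ R^*_{\mathrm{DD}}\ \ge\ \min\left\{\frac1{\mathrm e\ln2},\ \frac1{\mathrm e\ln2}\,\frac{1-\theta}{\theta}\right\}.$$ 3. If $\theta\ge\frac12$, then SCOMP is optimal: $R^*_{\mathrm{SCOMP}}$ equals the capacity, and both equal $$C=\max_{\nu>0}\min\left\{h(\mathrm e^{-\nu}),\ \frac{\nu}{\mathrm e^{\nu}\ln2}\,\frac{1-\theta}{\theta}\right\},$$ where $h$ is the binary entropy in bits and the maximum is attained. Moreover,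 no detection algorithm achieves a rate larger than $C$ along any $k(n)=\Theta(n^\theta)$. -/

import Mathlib

open scoped Asymptotics

/-- A nonadaptive test design with `n` items and `T` tests: `X t i = true` means that item `i` is
in the pool of test `t`. -/
abbrev Design (n T : ℕ) := Fin T → Fin n → Bool

/-- The test outcomes when the defective set is `K`: a test is positive iff it contains at least
one item of `K`. -/
def outcome {n T : ℕ} (X : Design n T) (K : Finset (Fin n)) : Fin T → Bool :=
  fun t => decide (∃ i ∈ K, X t i = true)

/-- `L` is satisfying: no negative test contains an item of `L`, and every positive test contains
at least one item of `L`. -/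
def IsSatisfying {n T : ℕ} (X : Design n T) (y : Fin T → Bool) (L : Finset (Fin n)) : Prop :=
  (∀ t, y t = false → ∀ i ∈ L, X t i = false) ∧ (∀ t, y t = true → ∃ i ∈ L, X t i = true)

/-- The possible defectives: the items that are in no negative test. -/
def possibleDefectives {n T : ℕ} (X : Design n T) (y : Fin T → Bool) : Finset (Fin n) :=
  Finset.univ.filter fun i => ∀ t, y t = false → X t i = false

/-- The output of DD: the items that are the only possible defective in some test. -/
def ddSet {n T : ℕ} (X : Design n T) (y : Fin T → Bool) : Finset (Fin n) :=
  Finset.univ.filter fun i =>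
    ∃ t, (possibleDefectives X y).filter (fun j => X t j = true) = {i}

/-- The positive tests that contain no item of `S`. -/
def unexplained {n T : ℕ} (X : Design n T) (y : Fin T → Bool) (S : Finset (Fin n)) :
    Finset (Fin T) :=
  Finset.univ.filter fun t => y t = true ∧ ∀ i ∈ S, X t i = false

/-- The number of unexplained tests (relative to the current estimate `S`) that contain `i`. -/
def gain {n T : ℕ} (X : Design n T) (y : Fin T → Bool) (S : Finset (Fin n)) (i : Fin n) : ℕ :=
  ((unexplained X y S).filter fun t => X t i = true).card

/-- One step of SCOMP: while a test is unexplained, add to the estimate `S` a possible defective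
outside `S` that is in the most unexplained tests (any of them, in case of ties). -/
def ScompStep {n T : ℕ} (X : Design n T) (y : Fin T → Bool) (S S' : Finset (Fin n)) : Prop :=
  (unexplained X y S).Nonempty ∧
    ∃ i ∈ possibleDefectives X y \ S,
      (∀ j ∈ possibleDefectives X y \ S, gain X y S j ≤ gain X y S i) ∧ S' = insert i S

/-- `S` is a possible output of SCOMP: it is reached from the DD set by finitely many SCOMP steps
and leaves no test unexplained. -/
def IsScompOutput {n T : ℕ} (X : Design n T) (y : Fin T → Bool) (S : Finset (Fin n)) : Prop :=
  Relation.ReflTransGen (ScompStep X y) (ddSet X y) S ∧ unexplained X y S = ∅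

/-- A (possibly randomized) detection algorithm: from the number `n` of items, the number `k` of
defectives, the number `T` of tests, the design and the outcomes it produces a random estimate of
the defective set. A deterministic algorithm has all its values of the form `PMF.pure _`, and an
algorithm is free to ignore `k`. -/
def DetectionAlgorithm : Type :=
  ∀ n _k T : ℕ, Design n T → (Fin T → Bool) → PMF (Finset (Fin n))

/-- The DD algorithm. -/
noncomputable def DD : DetectionAlgorithm := fun _ _ _ X y => PMF.pure (ddSet X y)

/-- `A` is an implementation of SCOMP, with some (deterministic or random) way of breaking ties:
for outcomes that arise from some defective set, `A` only outputs possible outputs of SCOMP. -/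
def IsSCOMP (A : DetectionAlgorithm) : Prop :=
  ∀ (n k T : ℕ) (X : Design n T) (K : Finset (Fin n)),
    ∀ S ∈ (A n k T X (outcome X K)).support, IsScompOutput X (outcome X K) S

/-- Whenever DD outputs a satisfying set, `A` outputs that same set. -/
def HasPropertyP (A : DetectionAlgorithm) : Prop :=
  ∀ (n k T : ℕ) (X : Design n T) (y : Fin T → Bool),
    IsSatisfying X y (ddSet X y) → A n k T X y = PMF.pure (ddSet X y)

/-- The probability of the design `X` when every item is in every test independently with
probability `p`. -/
noncomputable def bernoulliWeight {n T : ℕ} (p : ℝ) (X : Design n T) : ℝ :=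
  ∏ t, ∏ i, if X t i = true then p else 1 - p

/-- The average error probability of `A` with `n` items, `k` defectives and `T` Bernoulli(`p`)
tests: the average over all `K` of size `k` of the probability that the estimate is not `K`. -/
noncomputable def errorProb (A : DetectionAlgorithm) (n k T : ℕ) (p : ℝ) : ℝ :=
  (1 / (n.choose k : ℝ)) * ∑ K ∈ (Finset.univ : Finset (Fin n)).powersetCard k,
    ∑ X : Design n T, bernoulliWeight p X * (1 - (A n k T X (outcome X K) K).toReal)

/-- `R` is achieved by `A` with `k n` defectives among `n` items. -/
def IsAchievableAlong (k : ℕ → ℕ) (A : DetectionAlgorithm) (R : ℝ) : Prop :=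
  ∀ ε : ℝ, 0 < ε → ∀ᶠ n in Filter.atTop, ∃ p ∈ Set.Icc (0 : ℝ) 1, ∃ T : ℕ, 0 < T ∧
    R < Real.logb 2 (n.choose (k n) : ℝ) / (T : ℝ) ∧ errorProb A n (k n) T p < ε

/-- `k n = Θ(n ^ θ)`. -/
def HasSparsity (θ : ℝ) (k : ℕ → ℕ) : Prop :=
  (fun n : ℕ => (k n : ℝ)) =Θ[Filter.atTop] fun n : ℕ => (n : ℝ) ^ θ

/-- `R` is an achievable rate of `A` with Bernoulli tests and sparsity parameter `θ`. -/
def IsAchievable (θ : ℝ) (A : DetectionAlgorithm) (R : ℝ) : Prop :=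
  ∀ k : ℕ → ℕ, HasSparsity θ k → IsAchievableAlong k A R

/-- The maximum (supremum) achievable rate of `A`, in the extended reals. -/
noncomputable def maxRate (θ : ℝ) (A : DetectionAlgorithm) : EReal :=
  ⨆ R : {R : ℝ // IsAchievable θ A R}, ((R : ℝ) : EReal)

/-- The capacity of Bernoulli nonadaptive group testing: the supremum of the achievable rates of
all detection algorithms. -/
noncomputable def capacity (θ : ℝ) : EReal := ⨆ A : DetectionAlgorithm, maxRate θ A

/-- `min {h(e^(-ν)), (ν / (e^ν ln 2)) ((1 - θ) / θ)}`, with `h` the binary entropy in bits. -/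
noncomputable def capacityObjective (θ ν : ℝ) : ℝ :=
  min (Real.binEntropy (Real.exp (-ν)) / Real.log 2)
    (ν / (Real.exp ν * Real.log 2) * ((1 - θ) / θ))

/-! Two bounds on the rate meet when `θ ≥ 1/2`, and SCOMP inherits the lower one from DD. If the DD
set is satisfying, no test is unexplained and SCOMP stops at once. The true set `K` is always
satisfying, so SCOMP is right whenever DD is (`errorProb_le_of_hasPropertyP`).

Achievability (`isAchievableAlong_DD`). Take `p = 1 / k` and about `τ k log n` tests. DD never
outputs a nondefective item, so it errs only by missing some `i ∈ K`. A nondefective item stays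
possible with probability about `n ^ (-τ/e)`. If `τ/e > 1 - θ`, Markov's inequality leaves at most
`γ k` such intruders with high probability. Given so few, a fixed defective item is missed with
probability at most about `n ^ (-(1 - γ) τ/e)`. As `γ` can be small, the union bound over `K`
succeeds if `τ/e > θ`. Since `log (n.choose k) ~ (1 - θ) k log n`, the two conditions on `τ` become
the two terms of the minimum. The delicate point is that the set of possible defectives depends on
the design. `designProb_notMem_ddSet` conditions on the contents of the negative tests, which
determine that set, and compares it with a fixed set of size `m`.

Converse (`rate_le`, valid for every `θ` and uniform in `p`). Suppose `τ/e < θ`. By the second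
moment method some defective item is masked, that is, never the only defective in a test. By
Markov's inequality, with probability at least `1 - 1/a` for some fixed `a > 1`, there are so few
negative tests that a given nondefective item avoids them all with probability at least `n ^ (-θ)`;
as there are about `n` such items, one almost surely does. Swapping the two items leaves the
outcomes unchanged, so any algorithm errs with probability bounded away from zero. Hence `R ≤ (1 /
(e ln 2)) (1 - θ) / θ`.

For `θ ≥ 1/2` this is the smaller term of the DD bound, and it is the maximum of
`capacityObjective`, attained at `ν = 1`. -/

open Filter Topology

/-! ### Probability for Bernoulli rows and designs. -/

/-- The probability of a row of the design. -/
noncomputable def rowWeight {n : ℕ} (p : ℝ) (r : Fin n → Bool) : ℝ :=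
  ∏ i, if r i = true then p else 1 - p

open Classical in
/-- The probability of an event for one row of the design. -/
noncomputable def rowProb {n : ℕ} (p : ℝ) (E : (Fin n → Bool) → Prop) : ℝ :=
  ∑ r, if E r then rowWeight p r else 0

theorem rowProb_eq_sum {n : ℕ} (p : ℝ) (E : (Fin n → Bool) → Prop) [DecidablePred E] :
    rowProb p E = ∑ r, if E r then rowWeight p r else 0 := by
  rw [rowProb]
  congr!

open Classical in
/-- The probability of an event for the Bernoulli design. -/
noncomputable def designProb {n T : ℕ} (p : ℝ) (E : Design n T → Prop) : ℝ :=
  ∑ X, if E X then bernoulliWeight p X else 0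

theorem designProb_eq_sum {n T : ℕ} (p : ℝ) (E : Design n T → Prop) [DecidablePred E] :
    designProb p E = ∑ X, if E X then bernoulliWeight p X else 0 := by
  rw [designProb]
  congr!

theorem rowWeight_nonneg {n : ℕ} {p : ℝ} (hp : p ∈ Set.Icc (0 : ℝ) 1) (r : Fin n → Bool) :
    0 ≤ rowWeight p r := by
  refine Finset.prod_nonneg fun i _ => ?_
  split_ifs
  · exact hp.1
  · linarith [hp.2]

theorem bernoulliWeight_eq_prod_rowWeight {n T : ℕ} (p : ℝ) (X : Design n T) :
    bernoulliWeight p X = ∏ t, rowWeight p (X t) := rfl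

theorem bernoulliWeight_nonneg {n T : ℕ} {p : ℝ} (hp : p ∈ Set.Icc (0 : ℝ) 1) (X : Design n T) :
    0 ≤ bernoulliWeight p X :=
  Finset.prod_nonneg fun t _ => rowWeight_nonneg hp (X t)

theorem sum_prod_pi {ι β : Type*} [Fintype ι] [DecidableEq ι] [Fintype β] (f : ι → β → ℝ) :
    ∑ x : ι → β, ∏ i, f i (x i) = ∏ i, ∑ b, f i b := by
  rw [Finset.prod_univ_sum, Fintype.piFinset_univ]

theorem sum_rowWeight_mul_prod {n : ℕ} (p : ℝ) (g : Fin n → Bool → ℝ) :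
    ∑ r : Fin n → Bool, rowWeight p r * ∏ i, g i (r i)
      = ∏ i, (p * g i true + (1 - p) * g i false) := by
  simp_rw [rowWeight, ← Finset.prod_mul_distrib]
  rw [sum_prod_pi (fun i b => (if b = true then p else 1 - p) * g i b)]
  simp

theorem sum_rowWeight {n : ℕ} (p : ℝ) : ∑ r : Fin n → Bool, rowWeight p r = 1 := by
  simpa using sum_rowWeight_mul_prod (n := n) p (fun _ _ => 1)

theorem rowProb_agree {n : ℕ} (p : ℝ) (M : Finset (Fin n)) (b : Fin n → Bool) :
    rowProb p (fun r => ∀ i ∈ M, r i = b i) = ∏ i ∈ M, if b i = true then p else 1 - p := by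
  classical
  have h := sum_rowWeight_mul_prod p
    (fun i c => if i ∈ M then (if c = b i then (1 : ℝ) else 0) else 1)
  rw [rowProb_eq_sum]
  have h1 : ∀ r : Fin n → Bool, (if ∀ i ∈ M, r i = b i then rowWeight p r else 0)
      = rowWeight p r * ∏ i, (if i ∈ M then (if r i = b i then (1 : ℝ) else 0) else 1) := by
    intro r
    rw [Finset.prod_ite_mem, Finset.univ_inter, Finset.prod_ite_zero]
    simp
  rw [Finset.sum_congr rfl fun r _ => h1 r, h]
  rw [← Finset.prod_subset (Finset.subset_univ M)]
  · refine Finset.prod_congr rfl fun i hi => ?_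
    cases hb : b i <;> simp [hi]
  · intro i _ hi
    simp [hi]

theorem rowProb_only {n : ℕ} (p : ℝ) {M : Finset (Fin n)} {i : Fin n} (hi : i ∈ M) :
    rowProb p (fun r => M.filter (fun j => r j = true) = {i}) = p * (1 - p) ^ (M.card - 1) := by
  classical
  have h := rowProb_agree p M (fun j => decide (j = i))
  have h2 : (fun r : Fin n → Bool => M.filter (fun j => r j = true) = {i})
      = fun r => ∀ j ∈ M, r j = decide (j = i) := by
    funext r
    refine propext ⟨fun hr j hj => ?_, fun hr => ?_⟩
    · have := Finset.ext_iff.1 hr j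
      simp only [Finset.mem_filter, hj, true_and, Finset.mem_singleton] at this
      by_cases hji : j = i <;> simp_all
    · ext j
      simp only [Finset.mem_filter, Finset.mem_singleton]
      constructor
      · rintro ⟨hj, hrj⟩
        rw [hr j hj] at hrj
        simpa using hrj
      · rintro rfl
        exact ⟨hi, by simp [hr j hi]⟩
  rw [h2, h, ← Finset.mul_prod_erase M _ hi]
  rw [Finset.prod_congr rfl (g := fun _ => 1 - p)]
  · simp [Finset.card_erase_of_mem hi]
  · intro j hj
    simp [Finset.ne_of_mem_erase hj]

theorem rowProb_none {n : ℕ} (p : ℝ) (M : Finset (Fin n)) :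
    rowProb p (fun r => ∀ i ∈ M, r i = false) = (1 - p) ^ M.card := by
  rw [rowProb_agree p M (fun _ => false)]
  simp

theorem rowProb_not {n : ℕ} (p : ℝ) (E : (Fin n → Bool) → Prop) :
    rowProb p (fun r => ¬ E r) = 1 - rowProb p E := by
  classical
  rw [eq_sub_iff_add_eq, ← sum_rowWeight (n := n) p, rowProb_eq_sum, rowProb_eq_sum, ← Finset.sum_add_distrib]
  refine Finset.sum_congr rfl fun r _ => ?_
  by_cases h : E r <;> simp [h]

theorem rowProb_or {n : ℕ} (p : ℝ) {E F : (Fin n → Bool) → Prop} (h : ∀ r, E r → ¬ F r) :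
    rowProb p (fun r => E r ∨ F r) = rowProb p E + rowProb p F := by
  classical
  rw [rowProb_eq_sum, rowProb_eq_sum, rowProb_eq_sum, ← Finset.sum_add_distrib]
  refine Finset.sum_congr rfl fun r _ => ?_
  have := h r
  by_cases h1 : E r <;> by_cases h2 : F r <;> simp_all

theorem rowProb_nonneg {n : ℕ} {p : ℝ} (hp : p ∈ Set.Icc (0 : ℝ) 1) (E : (Fin n → Bool) → Prop) :
    0 ≤ rowProb p E := by
  classical
  rw [rowProb_eq_sum]
  exact Finset.sum_nonneg fun r _ => ite_nonneg (rowWeight_nonneg hp r) le_rfl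

theorem designProb_forall_row {n T : ℕ} (p : ℝ) (E : Fin T → (Fin n → Bool) → Prop) :
    designProb p (fun X : Design n T => ∀ t, E t (X t)) = ∏ t, rowProb p (E t) := by
  classical
  have h : ∀ X : Design n T, (if ∀ t, E t (X t) then bernoulliWeight p X else 0)
      = ∏ t, if E t (X t) then rowWeight p (X t) else 0 := by
    intro X
    rw [Finset.prod_ite_zero]
    simp [bernoulliWeight_eq_prod_rowWeight]
  rw [designProb_eq_sum, Finset.sum_congr rfl fun X _ => h X,
    sum_prod_pi (fun t r => if E t r then rowWeight p r else 0)]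
  simp [rowProb_eq_sum]

theorem designProb_forall {n T : ℕ} (p : ℝ) (E : (Fin n → Bool) → Prop) :
    designProb p (fun X : Design n T => ∀ t, E (X t)) = rowProb p E ^ T := by
  rw [designProb_forall_row p fun _ => E]
  simp

theorem designProb_row {n T : ℕ} (p : ℝ) (E : (Fin n → Bool) → Prop) (t : Fin T) :
    designProb p (fun X : Design n T => E (X t)) = rowProb p E := by
  have h : (fun X : Design n T => E (X t)) = fun X => ∀ s, s = t → E (X s) := by
    simp
  rw [h, designProb_forall_row p fun s r => s = t → E r,
    Finset.prod_eq_single t (fun s _ hs => ?_) (by simp)]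
  · simp
  · simp [hs, rowProb, sum_rowWeight]

theorem sum_bernoulliWeight {n T : ℕ} (p : ℝ) :
    ∑ X : Design n T, bernoulliWeight p X = 1 := by
  simp_rw [bernoulliWeight_eq_prod_rowWeight]
  rw [sum_prod_pi (fun _ r => rowWeight p r)]
  simp [sum_rowWeight]

theorem designProb_mono {n T : ℕ} {p : ℝ} (hp : p ∈ Set.Icc (0 : ℝ) 1)
    {E F : Design n T → Prop} (h : ∀ X, E X → F X) : designProb p E ≤ designProb p F := by
  classical
  rw [designProb_eq_sum, designProb_eq_sum]
  refine Finset.sum_le_sum fun X _ => ?_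
  have := h X
  have := bernoulliWeight_nonneg hp X
  by_cases h1 : E X <;> by_cases h2 : F X <;> simp_all

theorem designProb_not {n T : ℕ} (p : ℝ) (E : Design n T → Prop) :
    designProb p (fun X => ¬ E X) = 1 - designProb p E := by
  classical
  rw [eq_sub_iff_add_eq, ← sum_bernoulliWeight (n := n) (T := T) p, designProb_eq_sum, designProb_eq_sum,
    ← Finset.sum_add_distrib]
  refine Finset.sum_congr rfl fun r _ => ?_
  by_cases h : E r <;> simp [h]

theorem designProb_or_le {n T : ℕ} {p : ℝ} (hp : p ∈ Set.Icc (0 : ℝ) 1)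
    (E F : Design n T → Prop) :
    designProb p (fun X => E X ∨ F X) ≤ designProb p E + designProb p F := by
  classical
  rw [designProb_eq_sum, designProb_eq_sum, designProb_eq_sum, ← Finset.sum_add_distrib]
  refine Finset.sum_le_sum fun X _ => ?_
  have := bernoulliWeight_nonneg hp X
  by_cases h1 : E X <;> by_cases h2 : F X <;> simp [h1, h2, this]

theorem designProb_exists_le {n T : ℕ} {p : ℝ} (hp : p ∈ Set.Icc (0 : ℝ) 1) {ι : Type*}
    (s : Finset ι) (E : ι → Design n T → Prop) :
    designProb p (fun X => ∃ i ∈ s, E i X) ≤ ∑ i ∈ s, designProb p (E i) := by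
  classical
  induction s using Finset.induction_on with
  | empty => simp [designProb]
  | insert a s ha ih =>
    rw [Finset.sum_insert ha]
    refine le_trans (le_trans (designProb_mono hp (F := fun X => E a X ∨ ∃ i ∈ s, E i X) ?_)
      (designProb_or_le hp _ _)) (by gcongr)
    simp

/-- The expected number of indices for which an event holds. -/
theorem sum_bernoulliWeight_mul_card {n T : ℕ} (p : ℝ) {ι : Type*} (s : Finset ι)
    (E : ι → Design n T → Prop) [∀ i X, Decidable (E i X)] :
    ∑ X : Design n T, bernoulliWeight p X * ((s.filter fun i => E i X).card : ℝ)
      = ∑ i ∈ s, designProb p (E i) := by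
  simp_rw [Finset.card_filter, designProb_eq_sum]
  push_cast
  simp_rw [Finset.mul_sum]
  rw [Finset.sum_comm]
  simp

/-- Markov's inequality. -/
theorem designProb_card_le {n T : ℕ} {p : ℝ} (hp : p ∈ Set.Icc (0 : ℝ) 1) {ι : Type*}
    (s : Finset ι) (E : ι → Design n T → Prop) [∀ i X, Decidable (E i X)] (m : ℕ) :
    designProb p (fun X => m < (s.filter fun i => E i X).card)
      ≤ (∑ i ∈ s, designProb p (E i)) / ((m : ℝ) + 1) := by
  rw [le_div_iff₀ (by positivity), ← sum_bernoulliWeight_mul_card, designProb_eq_sum, Finset.sum_mul]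
  refine Finset.sum_le_sum fun X _ => ?_
  have := bernoulliWeight_nonneg hp X
  split_ifs with h
  · gcongr
    exact_mod_cast h
  · rw [zero_mul]
    positivity

open Classical in
/-- The second moment bound for the vanishing of a sum of pairwise negatively correlated
indicators. -/
theorem designProb_forall_not_le {n T : ℕ} {p : ℝ} (hp : p ∈ Set.Icc (0 : ℝ) 1) {ι : Type*}
    (s : Finset ι) (E : ι → Design n T → Prop) (a : ℝ)
    (h1 : ∀ i ∈ s, designProb p (E i) = a)
    (h2 : ∀ i ∈ s, ∀ j ∈ s, i ≠ j → designProb p (fun X => E i X ∧ E j X) ≤ a ^ 2)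
    (hm : 0 < s.card * a) :
    designProb p (fun X => ∀ i ∈ s, ¬ E i X) ≤ 1 / (s.card * a) := by
  set m : ℝ := s.card * a with hmdef
  let W : Design n T → ℝ := fun X => ((s.filter fun i => E i X).card : ℝ)
  have hW1 : ∑ X : Design n T, bernoulliWeight p X * W X = m := by
    rw [sum_bernoulliWeight_mul_card, Finset.sum_congr rfl h1]
    simp [hmdef]
  have hWW : ∀ X, W X * W X
      = (((s ×ˢ s).filter fun q : ι × ι => E q.1 X ∧ E q.2 X).card : ℝ) := by
    intro X
    simp only [W]
    rw [← Nat.cast_mul, ← Finset.card_product]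
    congr 2
    ext q
    simp only [Finset.mem_product, Finset.mem_filter]
    tauto
  have hW2 : ∑ X : Design n T, bernoulliWeight p X * (W X * W X) ≤ m + m ^ 2 := by
    simp_rw [hWW]
    refine le_trans (le_of_eq (Eq.trans ?_ (sum_bernoulliWeight_mul_card p (s ×ˢ s)
      (fun q X => E q.1 X ∧ E q.2 X)))) ?_
    · congr!
    rw [Finset.sum_product]
    have : ∀ i ∈ s, ∑ j ∈ s, designProb p (fun X : Design n T => E i X ∧ E j X)
        ≤ a + s.card * a ^ 2 := by
      intro i hi
      rw [← Finset.add_sum_erase s _ hi]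
      simp only [and_self]
      rw [h1 i hi]
      gcongr
      refine le_trans (Finset.sum_le_card_nsmul _ _ (a ^ 2) fun j hj => ?_) ?_
      · exact h2 i hi j (Finset.mem_of_mem_erase hj) (Finset.ne_of_mem_erase hj).symm
      · rw [nsmul_eq_mul]
        gcongr
        exact Finset.erase_subset _ _
    refine le_trans (Finset.sum_le_card_nsmul _ _ _ this) (le_of_eq ?_)
    rw [nsmul_eq_mul, hmdef]
    ring
  have hvar : ∑ X : Design n T, bernoulliWeight p X * (W X - m) ^ 2 ≤ m := by
    have : ∑ X : Design n T, bernoulliWeight p X * (W X - m) ^ 2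
        = ∑ X : Design n T, bernoulliWeight p X * (W X * W X)
          - 2 * m * ∑ X : Design n T, bernoulliWeight p X * W X
          + m ^ 2 * ∑ X : Design n T, bernoulliWeight p X := by
      rw [Finset.mul_sum, Finset.mul_sum, ← Finset.sum_sub_distrib, ← Finset.sum_add_distrib]
      exact Finset.sum_congr rfl fun X _ => by ring
    rw [this, hW1, sum_bernoulliWeight]
    nlinarith
  -- Chebyshev's inequality: on this event `W X = 0`, so each such design contributes `m ^ 2` times
  -- its weight to the variance.
  have hle : designProb p (fun X : Design n T => ∀ i ∈ s, ¬ E i X) * m ^ 2 ≤ m := by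
    refine le_trans ?_ hvar
    rw [designProb, Finset.sum_mul]
    refine Finset.sum_le_sum fun X _ => ?_
    have := bernoulliWeight_nonneg hp X
    split_ifs with h
    · have : W X = 0 := by
        simp only [W, Nat.cast_eq_zero, Finset.card_eq_zero]
        exact Finset.filter_eq_empty_iff.2 fun i hi => h i hi
      rw [this]
      simp
    · rw [zero_mul]
      positivity
  rw [le_div_iff₀ hm]
  nlinarith

/-- Domination under conditioning on a coordinatewise statistic `τ`: if, for each admissible value
of the statistic, the weight of `f` is at most that of `h` on each fibre, then the same holds for
the whole product. -/
theorem sum_prod_le_of_fiber {ι β S : Type*} [Fintype ι] [DecidableEq ι] [Fintype β]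
    [DecidableEq S]
    (w : ι → β → ℝ) (τ : ι → β → S) (good : (ι → S) → Prop)
    [DecidablePred good] (f : (ι → S) → ι → β → ℝ)
    (h : ι → β → ℝ) (hw : ∀ t b, 0 ≤ w t b) (hf : ∀ σ t b, 0 ≤ f σ t b) (hh : ∀ t b, 0 ≤ h t b)
    (hle : ∀ σ, good σ → ∀ t, ∑ b with τ t b = σ t, w t b * f σ t b
      ≤ ∑ b with τ t b = σ t, w t b * h t b) :
    (∑ x : ι → β, if good (fun t => τ t (x t)) then
        ∏ t, w t (x t) * f (fun t => τ t (x t)) t (x t) else 0)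
      ≤ ∏ t, ∑ b, w t b * h t b := by
  rw [← sum_prod_pi (fun t b => w t b * h t b)]
  -- Both sums are cut along the values `σ` of the statistic. With `σ` fixed, `f σ` no longer
  -- depends on the other coordinates, so each piece factors over `t`.
  rw [← Finset.sum_fiberwise_of_maps_to (s := Finset.univ)
    (t := Finset.univ.image fun (x : ι → β) t => τ t (x t))
    (g := fun (x : ι → β) t => τ t (x t)) (fun x _ => Finset.mem_image_of_mem _ (Finset.mem_univ x))]
  rw [← Finset.sum_fiberwise_of_maps_to (s := Finset.univ)
    (t := Finset.univ.image fun (x : ι → β) t => τ t (x t))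
    (g := fun (x : ι → β) t => τ t (x t)) (fun x _ => Finset.mem_image_of_mem _ (Finset.mem_univ x))]
  refine Finset.sum_le_sum fun σ _ => ?_
  have hfib : (Finset.univ.filter fun x : ι → β => (fun t => τ t (x t)) = σ)
      = Fintype.piFinset fun t => Finset.univ.filter fun b => τ t b = σ t := by
    ext x
    simp [Fintype.mem_piFinset, funext_iff]
  by_cases hσ : good σ
  · have h1 : ∀ x ∈ Finset.univ.filter (fun x : ι → β => (fun t => τ t (x t)) = σ),
        (if good (fun t => τ t (x t)) then
          ∏ t, w t (x t) * f (fun t => τ t (x t)) t (x t) else 0)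
        = ∏ t, w t (x t) * f σ t (x t) := by
      intro x hx
      have hx' := (Finset.mem_filter.1 hx).2
      rw [hx', if_pos hσ]
    rw [Finset.sum_congr rfl h1, hfib, ← Finset.prod_univ_sum _ (fun t b => w t b * f σ t b),
      ← Finset.prod_univ_sum _ (fun t b => w t b * h t b)]
    exact Finset.prod_le_prod
      (fun t _ => Finset.sum_nonneg fun b _ => mul_nonneg (hw t b) (hf σ t b))
      fun t _ => hle σ hσ t
  · refine Finset.sum_le_sum fun x hx => ?_
    have hx' := (Finset.mem_filter.1 hx).2
    rw [hx', if_neg hσ]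
    exact Finset.prod_nonneg fun t _ => mul_nonneg (hw t _) (hh t _)

/-! ### Combinatorics of outcomes, DD and SCOMP. -/

theorem outcome_eq_false_iff {n T : ℕ} (X : Design n T) (K : Finset (Fin n)) (t : Fin T) :
    outcome X K t = false ↔ ∀ i ∈ K, X t i = false := by
  simp [outcome]

theorem outcome_eq_true_iff {n T : ℕ} (X : Design n T) (K : Finset (Fin n)) (t : Fin T) :
    outcome X K t = true ↔ ∃ i ∈ K, X t i = true := by
  simp [outcome]

theorem mem_possibleDefectives {n T : ℕ} {X : Design n T} {y : Fin T → Bool} {i : Fin n} :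
    i ∈ possibleDefectives X y ↔ ∀ t, y t = false → X t i = false := by
  simp [possibleDefectives]

theorem subset_possibleDefectives {n T : ℕ} (X : Design n T) (K : Finset (Fin n)) :
    K ⊆ possibleDefectives X (outcome X K) := fun i hi =>
  mem_possibleDefectives.2 fun t ht => (outcome_eq_false_iff X K t).1 ht i hi

theorem mem_ddSet {n T : ℕ} {X : Design n T} {y : Fin T → Bool} {i : Fin n} :
    i ∈ ddSet X y ↔
      ∃ t, (possibleDefectives X y).filter (fun j => X t j = true) = {i} := by
  simp [ddSet]

/-- A test that isolates a possible defective must be positive; its defective item is itself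
possible, hence is the isolated one. -/
theorem ddSet_subset {n T : ℕ} (X : Design n T) (K : Finset (Fin n)) :
    ddSet X (outcome X K) ⊆ K := by
  intro i hi
  obtain ⟨t, ht⟩ := mem_ddSet.1 hi
  have hi' : i ∈ (possibleDefectives X (outcome X K)).filter fun j => X t j = true := by
    rw [ht]
    exact Finset.mem_singleton_self i
  rw [Finset.mem_filter] at hi'
  have htrue : outcome X K t = true := by
    by_contra hne
    have := mem_possibleDefectives.1 hi'.1 t (by simpa using hne)
    simp [hi'.2] at this
  obtain ⟨j, hj, hXj⟩ := (outcome_eq_true_iff X K t).1 htrue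
  have hj' : j ∈ (possibleDefectives X (outcome X K)).filter fun j => X t j = true :=
    Finset.mem_filter.2 ⟨subset_possibleDefectives X K hj, hXj⟩
  rw [ht, Finset.mem_singleton] at hj'
  exact hj' ▸ hj

theorem isSatisfying_outcome {n T : ℕ} (X : Design n T) (K : Finset (Fin n)) :
    IsSatisfying X (outcome X K) K :=
  ⟨fun t => (outcome_eq_false_iff X K t).1, fun t => (outcome_eq_true_iff X K t).1⟩

theorem IsSatisfying.outcome_eq {n T : ℕ} {X : Design n T} {y : Fin T → Bool}
    {L : Finset (Fin n)} (h : IsSatisfying X y L) : outcome X L = y := by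
  funext t
  cases hy : y t with
  | false => exact (outcome_eq_false_iff X L t).2 (h.1 t hy)
  | true => exact (outcome_eq_true_iff X L t).2 (h.2 t hy)

theorem IsScompOutput.eq_ddSet {n T : ℕ} {X : Design n T} {y : Fin T → Bool}
    {S : Finset (Fin n)} (hS : IsScompOutput X y S) (h : IsSatisfying X y (ddSet X y)) :
    S = ddSet X y := by
  rcases Relation.ReflTransGen.cases_head hS.1 with h1 | ⟨S', h1, -⟩
  · exact h1.symm
  · obtain ⟨⟨t, ht⟩, -⟩ := h1
    simp only [unexplained, Finset.mem_filter, Finset.mem_univ, true_and] at ht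
    obtain ⟨i, hi, hXi⟩ := h.2 t ht.1
    simp [ht.2 i hi] at hXi

theorem PMF.eq_pure_of_support {α : Type*} (q : PMF α) (a : α) (h : ∀ x ∈ q.support, x = a) :
    q = PMF.pure a := by
  have hs : q.support = {a} := by
    obtain ⟨x, hx⟩ := q.support_nonempty
    exact Set.eq_singleton_iff_unique_mem.2 ⟨h x hx ▸ hx, h⟩
  ext x
  by_cases hx : x = a
  · subst hx
    simpa using (q.apply_eq_one_iff x).2 hs
  · have : x ∉ q.support := by simpa [hs] using hx
    rw [(q.apply_eq_zero_iff x).2 this, PMF.pure_apply_of_ne _ _ hx]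

theorem IsSCOMP.hasPropertyP {A : DetectionAlgorithm} (hA : IsSCOMP A) : HasPropertyP A := by
  intro n k T X y h
  refine PMF.eq_pure_of_support _ _ fun S hS => ?_
  have hy := h.outcome_eq
  -- `IsSCOMP` speaks only of outcomes that come from a defective set; a satisfying DD set is itself
  -- such a set for `y`.
  have := hA n k T X (ddSet X y) S (by rwa [hy])
  rw [hy] at this
  exact this.eq_ddSet h

theorem errorProb_le_of_hasPropertyP {A : DetectionAlgorithm} (hA : HasPropertyP A)
    (n k T : ℕ) {p : ℝ} (hp : p ∈ Set.Icc (0 : ℝ) 1) :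
    errorProb A n k T p ≤ errorProb DD n k T p := by
  unfold errorProb
  refine mul_le_mul_of_nonneg_left (Finset.sum_le_sum fun K _ => Finset.sum_le_sum fun X _ =>
    mul_le_mul_of_nonneg_left ?_ (bernoulliWeight_nonneg hp X)) (by positivity)
  refine sub_le_sub_left ?_ 1
  by_cases hK : ddSet X (outcome X K) = K
  · have h := hA n k T X (outcome X K) (by rw [hK]; exact isSatisfying_outcome X K)
    rw [h]
    exact le_rfl
  · have : DD n k T X (outcome X K) K = 0 := PMF.pure_apply_of_ne _ _ fun h => hK h.symm
    rw [this]
    simp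

theorem IsAchievableAlong.of_hasPropertyP {A : DetectionAlgorithm} (hA : HasPropertyP A)
    {k : ℕ → ℕ} {R : ℝ} (h : IsAchievableAlong k DD R) : IsAchievableAlong k A R := by
  intro ε hε
  filter_upwards [h ε hε] with n hn
  obtain ⟨p, hp, T, hT, hR, herr⟩ := hn
  exact ⟨p, hp, T, hT, hR, (errorProb_le_of_hasPropertyP hA n (k n) T hp).trans_lt herr⟩

/-! ### Nonasymptotic error bound for DD. -/

theorem errorProb_le_of_forall {A : DetectionAlgorithm} {n k T : ℕ} (hk : k ≤ n) {p b : ℝ}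
    (h : ∀ K : Finset (Fin n), K.card = k →
      ∑ X : Design n T, bernoulliWeight p X * (1 - (A n k T X (outcome X K) K).toReal) ≤ b) :
    errorProb A n k T p ≤ b := by
  have hc : (0 : ℝ) < n.choose k := by exact_mod_cast Nat.choose_pos hk
  unfold errorProb
  refine le_trans (mul_le_mul_of_nonneg_left (Finset.sum_le_card_nsmul _ _ b fun K hK => ?_)
    (by positivity)) (le_of_eq ?_)
  · exact h K (Finset.mem_powersetCard.1 hK).2
  · rw [Finset.card_powersetCard, Finset.card_univ, Fintype.card_fin, nsmul_eq_mul]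
    field_simp

theorem sum_DD_error {n k T : ℕ} (p : ℝ) (K : Finset (Fin n)) :
    ∑ X : Design n T, bernoulliWeight p X * (1 - (DD n k T X (outcome X K) K).toReal)
      = designProb p (fun X : Design n T => ddSet X (outcome X K) ≠ K) := by
  classical
  rw [designProb_eq_sum]
  refine Finset.sum_congr rfl fun X _ => ?_
  by_cases h : ddSet X (outcome X K) = K
  · simp [DD, h]
  · simp [DD, h, PMF.pure_apply_of_ne _ _ (Ne.symm h)]

/-- The probability that a nondefective item is in no negative test. -/
theorem designProb_mem_possibleDefectives {n T : ℕ} (p : ℝ) {K : Finset (Fin n)} {j : Fin n}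
    (hj : j ∉ K) :
    designProb p (fun X : Design n T => j ∈ possibleDefectives X (outcome X K))
      = (1 - p * (1 - p) ^ K.card) ^ T := by
  -- A test rules out `j` exactly when `j` is its only item from `insert j K`.
  have h : (fun X : Design n T => j ∈ possibleDefectives X (outcome X K))
      = fun X => ∀ t, ¬ ((insert j K).filter (fun i => X t i = true) = {j}) := by
    funext X
    refine propext (mem_possibleDefectives.trans (forall_congr' fun t => ?_))
    rw [outcome_eq_false_iff, Finset.filter_insert]
    constructor
    · intro h1 h2
      split_ifs at h2 with hXj
      · have h3 : ∀ i ∈ K, X t i = false := by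
          intro i hi
          by_contra hne
          have : i ∈ insert j (K.filter fun i => X t i = true) := by
            simp [hi, Bool.eq_true_of_not_eq_false hne]
          rw [h2, Finset.mem_singleton] at this
          exact hj (this ▸ hi)
        simp [h1 h3] at hXj
      · have : j ∈ K.filter fun i => X t i = true := by simp [h2]
        exact hj (Finset.mem_filter.1 this).1
    · intro h1 h2
      by_contra hne
      refine h1 ?_
      rw [if_pos (Bool.eq_true_of_not_eq_false hne), Finset.filter_eq_empty_iff.2]
      · rfl
      · intro i hi
        simp [h2 i hi]
  rw [h, designProb_forall p (fun r => ¬ ((insert j K).filter (fun i => r i = true) = {j})),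
    rowProb_not, rowProb_only p (Finset.mem_insert_self j K), Finset.card_insert_of_notMem hj]
  simp

theorem designProb_possibleDefectives_card_gt {n T : ℕ} {p : ℝ} (hp : p ∈ Set.Icc (0 : ℝ) 1)
    (K : Finset (Fin n)) (g : ℕ) :
    designProb p (fun X : Design n T => K.card + g < (possibleDefectives X (outcome X K)).card)
      ≤ ((n - K.card : ℕ) : ℝ) * (1 - p * (1 - p) ^ K.card) ^ T / ((g : ℝ) + 1) := by
  classical
  refine le_trans (designProb_mono hp (F := fun X : Design n T =>
    g < (Kᶜ.filter fun j => j ∈ possibleDefectives X (outcome X K)).card) ?_)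
    (le_trans (designProb_card_le hp Kᶜ
      (fun j X => j ∈ possibleDefectives X (outcome X K)) g) (le_of_eq ?_))
  · intro X hX
    have h1 : possibleDefectives X (outcome X K)
        ⊆ K ∪ Kᶜ.filter fun j => j ∈ possibleDefectives X (outcome X K) := by
      intro i hi
      by_cases hK : i ∈ K <;> simp [hi, hK]
    have h2 := (Finset.card_le_card h1).trans (Finset.card_union_le _ _)
    omega
  · rw [Finset.sum_congr rfl fun j hj =>
      designProb_mem_possibleDefectives p (Finset.mem_compl.1 hj)]
    simp [Finset.card_compl]

/-- The trace of a row on the negative tests: the row itself if it contains no item of `K`. -/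
def negativeTrace {n : ℕ} (K : Finset (Fin n)) (r : Fin n → Bool) : Option (Fin n → Bool) :=
  if ∃ i ∈ K, r i = true then none else some r

/-- The possible defectives, recovered from the traces of the rows on the negative tests. -/
def traceDefectives {n T : ℕ} (σ : Fin T → Option (Fin n → Bool)) : Finset (Fin n) :=
  Finset.univ.filter fun i => ∀ t, ∀ r ∈ σ t, r i = false

theorem traceDefectives_negativeTrace {n T : ℕ} (K : Finset (Fin n)) (X : Design n T) :
    traceDefectives (fun t => negativeTrace K (X t)) = possibleDefectives X (outcome X K) := by
  ext i
  simp only [traceDefectives, Finset.mem_filter, Finset.mem_univ, true_and,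
    mem_possibleDefectives]
  refine forall_congr' fun t => ?_
  unfold negativeTrace
  split_ifs with h
  · simp [(outcome_eq_true_iff X K t).2 h]
  · have : outcome X K t = false := by
      rw [← Bool.not_eq_true, outcome_eq_true_iff]
      exact h
    simp [this]

/-- If there are few possible defectives, DD is unlikely to miss a given defective item. -/
theorem designProb_notMem_ddSet {n T : ℕ} {p : ℝ} (hp : p ∈ Set.Icc (0 : ℝ) 1)
    {K : Finset (Fin n)} {i : Fin n} (hi : i ∈ K) {m : ℕ} (hKm : K.card ≤ m) (hm : m ≤ n) :
    designProb p (fun X : Design n T => (possibleDefectives X (outcome X K)).card ≤ m ∧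
      i ∉ ddSet X (outcome X K)) ≤ (1 - p * (1 - p) ^ (m - 1)) ^ T := by
  classical
  -- `M` is a fixed stand-in for the random set of possible defectives, of the largest size allowed.
  obtain ⟨M, hKM, -, hM⟩ := Finset.exists_subsuperset_card_eq (Finset.subset_univ K) hKm
    (by simpa using hm)
  have hiM : i ∈ M := hKM hi
  -- The second condition is automatic for traces of designs, but the fibre inequality is needed for
  -- every abstract `σ`.
  let good : (Fin T → Option (Fin n → Bool)) → Prop := fun σ =>
    (traceDefectives σ).card ≤ m ∧ i ∈ traceDefectives σ
  let f : (Fin T → Option (Fin n → Bool)) → Fin T → (Fin n → Bool) → ℝ := fun σ _ r =>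
    if (traceDefectives σ).filter (fun j => r j = true) = {i} then 0 else 1
  let h : Fin T → (Fin n → Bool) → ℝ := fun _ r =>
    if M.filter (fun j => r j = true) = {i} then 0 else 1
  have key := sum_prod_le_of_fiber (fun _ r => rowWeight p r) (fun (_ : Fin T) => negativeTrace K)
    good f h (fun _ r => rowWeight_nonneg hp r) (fun σ t r => by simp only [f]; split_ifs <;> simp)
    (fun t r => by simp only [h]; split_ifs <;> simp) ?_
  · refine le_trans (le_of_eq ?_) (key.trans (le_of_eq ?_))
    · rw [designProb_eq_sum]
      refine Finset.sum_congr rfl fun X _ => ?_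
      simp only [good, f, traceDefectives_negativeTrace]
      have hiP : i ∈ possibleDefectives X (outcome X K) := subset_possibleDefectives X K hi
      simp only [hiP, and_true, mem_ddSet, not_exists]
      by_cases hc : (possibleDefectives X (outcome X K)).card ≤ m
      · simp only [hc, true_and, if_true]
        rw [Finset.prod_mul_distrib, ← bernoulliWeight_eq_prod_rowWeight]
        by_cases hall : ∀ t, ¬ (possibleDefectives X (outcome X K)).filter
            (fun j => X t j = true) = {i}
        · rw [if_pos hall, Finset.prod_congr rfl fun t _ => if_neg (hall t)]
          simp
        · rw [if_neg hall]
          obtain ⟨t, ht⟩ := not_forall_not.1 hall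
          have h0 : ∏ t, (if (possibleDefectives X (outcome X K)).filter
              (fun j => X t j = true) = {i} then (0 : ℝ) else 1) = 0 :=
            Finset.prod_eq_zero (Finset.mem_univ t) (if_pos ht)
          rw [h0, mul_zero]
      · simp [hc]
    · simp only [h]
      rw [Finset.prod_const, Finset.card_univ, Fintype.card_fin]
      congr 1
      rw [← hM, ← rowProb_only p hiM, ← rowProb_not, rowProb_eq_sum]
      refine Finset.sum_congr rfl fun r _ => ?_
      split_ifs <;> simp_all
  · rintro σ ⟨hσm, hσi⟩ t
    rcases hσ : σ t with _ | r₀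
    -- Isolating `i` within `L` forces the test to be positive, so the whole isolation probability
    -- is removed from this fibre. A smaller `L` removes more, whence the comparison with `M`.
    · have hfib : ∀ L : Finset (Fin n), i ∈ L →
          ∑ r with negativeTrace K r = none, rowWeight p r *
            (if L.filter (fun j => r j = true) = {i} then 0 else 1)
          = ∑ r with negativeTrace K r = none, rowWeight p r - p * (1 - p) ^ (L.card - 1) := by
        intro L hL
        rw [← rowProb_only p hL, rowProb_eq_sum, eq_sub_iff_add_eq, Finset.sum_filter,
          Finset.sum_filter, ← Finset.sum_add_distrib]
        refine Finset.sum_congr rfl fun r _ => ?_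
        by_cases hr : L.filter (fun j => r j = true) = {i}
        · have hri : r i = true := by
            have : i ∈ L.filter (fun j => r j = true) := by simp [hr]
            exact (Finset.mem_filter.1 this).2
          have hn : negativeTrace K r = none := if_pos ⟨i, hi, hri⟩
          simp [hr, hn]
        · simp [hr]
      simp only [f, h]
      rw [hfib _ hσi, hfib _ hiM, hM]
      refine sub_le_sub_left (mul_le_mul_of_nonneg_left ?_ hp.1) _
      exact pow_le_pow_of_le_one (by linarith [hp.2]) (by linarith [hp.1]) (by omega)
    -- A negative test does not contain `i`, so it cannot isolate it and `h` equals one here.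
    · refine Finset.sum_le_sum fun r hr => mul_le_mul_of_nonneg_left ?_ (rowWeight_nonneg hp r)
      have hr' : negativeTrace K r = some r₀ := (Finset.mem_filter.1 hr).2
      have hri : r i = false := by
        unfold negativeTrace at hr'
        split_ifs at hr' with h1
        by_contra hne
        exact h1 ⟨i, hi, Bool.eq_true_of_not_eq_false hne⟩
      have hne : ¬ M.filter (fun j => r j = true) = {i} := by
        intro h1
        have : i ∈ M.filter (fun j => r j = true) := by simp [h1]
        simp [hri] at this
      simp only [f, h, if_neg hne]
      split_ifs <;> simp

/-- The error probability of DD with at most `g` nondefective possible defectives allowed for. -/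
theorem errorProb_DD_le {n k T g : ℕ} {p : ℝ} (hp : p ∈ Set.Icc (0 : ℝ) 1) (hn : k + g ≤ n) :
    errorProb DD n k T p ≤ ((n - k : ℕ) : ℝ) * (1 - p * (1 - p) ^ k) ^ T / ((g : ℝ) + 1)
      + k * (1 - p * (1 - p) ^ (k + g - 1)) ^ T := by
  refine errorProb_le_of_forall (by omega) fun K hK => ?_
  rw [sum_DD_error]
  refine le_trans (designProb_mono hp (F := fun X : Design n T =>
    K.card + g < (possibleDefectives X (outcome X K)).card ∨
    ∃ i ∈ K, (possibleDefectives X (outcome X K)).card ≤ k + g ∧ i ∉ ddSet X (outcome X K)) ?_)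
    (le_trans (designProb_or_le hp _ _) (add_le_add ?_ ?_))
  · intro X hX
    by_contra hcon
    push Not at hcon
    refine hX (Finset.Subset.antisymm (ddSet_subset X K) fun i hi => ?_)
    exact hcon.2 i hi (by omega)
  · have := designProb_possibleDefectives_card_gt (T := T) hp K g
    simpa only [hK] using this
  · refine le_trans (designProb_exists_le hp K _) (le_trans (Finset.sum_le_card_nsmul _ _ _
      fun i hi => designProb_notMem_ddSet hp hi (by omega) hn) ?_)
    rw [nsmul_eq_mul, hK]

/-! ### Nonasymptotic converse: ambiguous defective sets. -/

theorem PMF.sum_toReal_le_one {α : Type*} (q : PMF α) (s : Finset α) :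
    ∑ a ∈ s, (q a).toReal ≤ 1 := by
  rw [← ENNReal.toReal_sum fun a _ => q.apply_ne_top a]
  refine ENNReal.toReal_le_of_le_ofReal zero_le_one ?_
  rw [ENNReal.ofReal_one, ← q.tsum_coe]
  exact ENNReal.sum_le_tsum s

theorem PMF.toReal_apply_le_one {α : Type*} (q : PMF α) (a : α) : (q a).toReal ≤ 1 := by
  simpa using q.sum_toReal_le_one {a}

/-- Some other set of the same size as `K` leads to the same test outcomes. -/
def IsAmbiguous {n T : ℕ} (X : Design n T) (K : Finset (Fin n)) : Prop :=
  ∃ K' : Finset (Fin n), K' ≠ K ∧ K'.card = K.card ∧ outcome X K' = outcome X K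

-- Among the `c` sets of size `k` with a given outcome vector, the success probabilities add up to
-- at most one. If `c ≥ 2`, the errors thus add up to at least `c - 1 ≥ c / 2`; if `c ≤ 1`, no set
-- in the class is ambiguous.
open Classical in
theorem card_isAmbiguous_le {n k T : ℕ} (A : DetectionAlgorithm) (X : Design n T) :
    (1 / 2 : ℝ) * (((Finset.univ : Finset (Fin n)).powersetCard k).filter (IsAmbiguous X)).card
      ≤ ∑ K ∈ (Finset.univ : Finset (Fin n)).powersetCard k,
        (1 - (A n k T X (outcome X K) K).toReal) := by
  rw [Finset.card_filter]
  push_cast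
  rw [Finset.mul_sum,
    ← Finset.sum_fiberwise_of_maps_to (t := Finset.univ) (g := outcome X) (by simp),
    ← Finset.sum_fiberwise_of_maps_to (t := Finset.univ) (g := outcome X)
      (f := fun K => 1 - (A n k T X (outcome X K) K).toReal) (by simp)]
  refine Finset.sum_le_sum fun y _ => ?_
  set C := ((Finset.univ : Finset (Fin n)).powersetCard k).filter fun K => outcome X K = y
  have hC : ∀ K, K ∈ C ↔ K.card = k ∧ outcome X K = y := by simp [C, Finset.mem_powersetCard]
  have h1 : ∑ K ∈ C, (1 - (A n k T X (outcome X K) K).toReal)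
      = C.card - ∑ K ∈ C, (A n k T X y K).toReal := by
    rw [Finset.sum_sub_distrib]
    congr 1
    · simp
    · exact Finset.sum_congr rfl fun K hK => by rw [((hC K).1 hK).2]
  by_cases h2 : 1 < C.card
  · have h3 : ∑ K ∈ C, (1 / 2 : ℝ) * (if IsAmbiguous X K then 1 else 0) ≤ 1 / 2 * C.card := by
      refine le_trans (Finset.sum_le_card_nsmul _ _ (1 / 2) fun K _ => ?_) (le_of_eq ?_)
      · split_ifs <;> norm_num
      · rw [nsmul_eq_mul, mul_comm]
    have h4 := (A n k T X y).sum_toReal_le_one C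
    have h5 : (2 : ℝ) ≤ C.card := by exact_mod_cast h2
    rw [h1]
    linarith
  · rw [Finset.sum_eq_zero]
    · exact Finset.sum_nonneg fun K _ => sub_nonneg.2 (PMF.toReal_apply_le_one _ _)
    · intro K hK
      rw [if_neg, mul_zero]
      rintro ⟨K', hne, hcard, hout⟩
      refine h2 (Finset.one_lt_card.2 ⟨K', ?_, K, hK, hne⟩)
      rw [hC] at hK ⊢
      exact ⟨hcard.trans hK.1, hout.trans hK.2⟩

theorem errorProb_ge_of_forall {A : DetectionAlgorithm} {n k T : ℕ} (hk : k ≤ n) {p b : ℝ}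
    (hp : p ∈ Set.Icc (0 : ℝ) 1)
    (h : ∀ K : Finset (Fin n), K.card = k → b ≤ designProb p fun X : Design n T => IsAmbiguous X K) :
    b / 2 ≤ errorProb A n k T p := by
  classical
  have hc : (0 : ℝ) < n.choose k := by exact_mod_cast Nat.choose_pos hk
  unfold errorProb
  rw [Finset.sum_comm]
  have h1 : ∑ X : Design n T, bernoulliWeight p X * ((1 / 2 : ℝ) *
      (((Finset.univ : Finset (Fin n)).powersetCard k).filter fun K => IsAmbiguous X K).card)
      ≤ ∑ X : Design n T, ∑ K ∈ (Finset.univ : Finset (Fin n)).powersetCard k,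
        bernoulliWeight p X * (1 - (A n k T X (outcome X K) K).toReal) := by
    refine Finset.sum_le_sum fun X _ => ?_
    rw [← Finset.mul_sum]
    refine mul_le_mul_of_nonneg_left ?_ (bernoulliWeight_nonneg hp X)
    convert card_isAmbiguous_le A X
  have h2 : (n.choose k : ℝ) * (b / 2) ≤ ∑ X : Design n T, bernoulliWeight p X * ((1 / 2 : ℝ) *
      (((Finset.univ : Finset (Fin n)).powersetCard k).filter fun K => IsAmbiguous X K).card) := by
    simp_rw [mul_left_comm _ (1 / 2 : ℝ)]
    rw [← Finset.mul_sum, sum_bernoulliWeight_mul_card p _ fun K (X : Design n T) => IsAmbiguous X K]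
    have := Finset.card_nsmul_le_sum ((Finset.univ : Finset (Fin n)).powersetCard k) _ b
      fun K hK => h K (Finset.mem_powersetCard.1 hK).2
    rw [Finset.card_powersetCard, Finset.card_univ, Fintype.card_fin, nsmul_eq_mul] at this
    linarith
  rw [one_div, ← div_eq_inv_mul, le_div_iff₀ hc]
  linarith

/-- Swapping a defective item that is never the only defective item of a test for a nondefective
possible defective does not change the outcomes. -/
theorem isAmbiguous_of_masked {n T : ℕ} {X : Design n T} {K : Finset (Fin n)} {i j : Fin n}
    (hi : i ∈ K) (hj : j ∉ K) (hmask : ∀ t, ¬ K.filter (fun l => X t l = true) = {i})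
    (hpos : j ∈ possibleDefectives X (outcome X K)) : IsAmbiguous X K := by
  have hji : j ∉ K.erase i := fun h => hj (Finset.mem_of_mem_erase h)
  refine ⟨insert j (K.erase i), fun h => hj (h ▸ Finset.mem_insert_self _ _), ?_, ?_⟩
  · rw [Finset.card_insert_of_notMem hji, Finset.card_erase_add_one hi]
  · funext t
    rw [Bool.eq_iff_iff, outcome_eq_true_iff, outcome_eq_true_iff]
    constructor
    · rintro ⟨l, hl, hXl⟩
      rcases Finset.mem_insert.1 hl with rfl | hl
      · by_contra hcon
        rw [← outcome_eq_true_iff, Bool.not_eq_true] at hcon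
        simp [mem_possibleDefectives.1 hpos t hcon] at hXl
      · exact ⟨l, Finset.mem_of_mem_erase hl, hXl⟩
    · rintro ⟨l, hl, hXl⟩
      by_contra hcon
      refine hmask t (Finset.ext fun m => ?_)
      have hother : ∀ m ∈ K, X t m = true → m = i := by
        intro m hm hXm
        by_contra hmi
        exact hcon ⟨m, Finset.mem_insert_of_mem (Finset.mem_erase.2 ⟨hmi, hm⟩), hXm⟩
      rw [Finset.mem_filter, Finset.mem_singleton]
      refine ⟨fun h => hother m h.1 h.2, ?_⟩
      rintro rfl
      exact ⟨hi, hother l hl hXl ▸ hXl⟩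

/-- One test cannot isolate two defective items, so with `q` the isolation probability two items are
both masked with probability `(1 - 2 q) ^ T ≤ (1 - q) ^ (2 T)`. This is the negative correlation
that the second moment bound requires. -/
theorem designProb_no_masked_le {n T : ℕ} {p : ℝ} (hp : p ∈ Set.Icc (0 : ℝ) 1)
    (K : Finset (Fin n)) (hpos : 0 < K.card * (1 - p * (1 - p) ^ (K.card - 1)) ^ T) :
    designProb p (fun X : Design n T =>
      ∀ i ∈ K, ¬ ∀ t, ¬ K.filter (fun l => X t l = true) = {i})
      ≤ 1 / (K.card * (1 - p * (1 - p) ^ (K.card - 1)) ^ T) := by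
  refine designProb_forall_not_le hp K
    (fun i (X : Design n T) => ∀ t, ¬ K.filter (fun l => X t l = true) = {i}) _ ?_ ?_ hpos
  · intro i hi
    rw [designProb_forall p fun r => ¬ K.filter (fun l => r l = true) = {i}, rowProb_not,
      rowProb_only p hi]
  · intro i hi j hj hij
    have h1 : (fun X : Design n T => (∀ t, ¬ K.filter (fun l => X t l = true) = {i}) ∧
        ∀ t, ¬ K.filter (fun l => X t l = true) = {j})
        = fun X => ∀ t, ¬ (K.filter (fun l => X t l = true) = {i} ∨
          K.filter (fun l => X t l = true) = {j}) := by
      funext X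
      simp only [not_or, forall_and]
    have h2 := rowProb_not p (n := n) fun r =>
      K.filter (fun l => r l = true) = {i} ∨ K.filter (fun l => r l = true) = {j}
    have h0 := rowProb_nonneg hp (n := n) fun r =>
      ¬ (K.filter (fun l => r l = true) = {i} ∨ K.filter (fun l => r l = true) = {j})
    rw [rowProb_or p, rowProb_only p hi, rowProb_only p hj] at h2
    · rw [h1, designProb_forall p fun r => ¬ (K.filter (fun l => r l = true) = {i} ∨
        K.filter (fun l => r l = true) = {j}), ← pow_mul, mul_comm T 2, pow_mul]
      refine pow_le_pow_left₀ h0 ?_ T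
      rw [h2]
      nlinarith [sq_nonneg (p * (1 - p) ^ (K.card - 1))]
    · intro r hri hrj
      rw [hri] at hrj
      exact hij (Finset.singleton_injective hrj)

theorem designProb_negative_card_gt {n T : ℕ} {p : ℝ} (hp : p ∈ Set.Icc (0 : ℝ) 1)
    (K : Finset (Fin n)) (m : ℕ) :
    designProb p (fun X : Design n T =>
      m < (Finset.univ.filter fun t => ∀ i ∈ K, X t i = false).card)
      ≤ T * (1 - p) ^ K.card / ((m : ℝ) + 1) := by
  refine le_trans (designProb_card_le hp Finset.univ
    (fun t (X : Design n T) => ∀ i ∈ K, X t i = false) m) (le_of_eq ?_)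
  congr 1
  rw [Finset.sum_congr rfl fun t _ =>
    (designProb_row p (fun r => ∀ i ∈ K, r i = false) t).trans (rowProb_none p K)]
  simp

/-- The negative tests, recovered from the columns of the defective items. -/
def columnNegatives {n T : ℕ} (σ : Fin n → Option (Fin T → Bool)) : Finset (Fin T) :=
  Finset.univ.filter fun t => ∀ i, ∀ c ∈ σ i, c t = false

theorem columnNegatives_ite {n T : ℕ} (K : Finset (Fin n)) (x : Fin n → Fin T → Bool) :
    columnNegatives (fun i => if i ∈ K then some (x i) else none)
      = Finset.univ.filter fun t => ∀ i ∈ K, x i t = false := by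
  ext t
  simp [columnNegatives]

/-- If there are few negative tests, then some nondefective item is likely to avoid them all. -/
theorem designProb_no_nondefective_le {n T : ℕ} {p : ℝ} (hp : p ∈ Set.Icc (0 : ℝ) 1)
    (K : Finset (Fin n)) (m : ℕ) :
    designProb p (fun X : Design n T =>
      (Finset.univ.filter fun t => ∀ i ∈ K, X t i = false).card ≤ m ∧
        ∀ j ∉ K, j ∉ possibleDefectives X (outcome X K))
      ≤ (1 - (1 - p) ^ m) ^ (n - K.card) := by
  classical
  have hp0 : (0 : ℝ) ≤ 1 - p := by linarith [hp.2]
  have hp1 : 1 - p ≤ (1 : ℝ) := by linarith [hp.1]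
  let good : (Fin n → Option (Fin T → Bool)) → Prop := fun σ => (columnNegatives σ).card ≤ m
  let τ : Fin n → (Fin T → Bool) → Option (Fin T → Bool) := fun i c =>
    if i ∈ K then some c else none
  let f : (Fin n → Option (Fin T → Bool)) → Fin n → (Fin T → Bool) → ℝ := fun σ i c =>
    if i ∉ K ∧ ∀ t ∈ columnNegatives σ, c t = false then 0 else 1
  let h : Fin n → (Fin T → Bool) → ℝ := fun i _ => if i ∈ K then 1 else 1 - (1 - p) ^ m
  have hm1 : (1 - p) ^ m ≤ 1 := pow_le_one₀ hp0 hp1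
  have key := sum_prod_le_of_fiber (fun _ c => rowWeight p c) τ good f h
    (fun _ c => rowWeight_nonneg hp c) (fun σ t r => by simp only [f]; split_ifs <;> simp)
    (fun t r => by simp only [h]; split_ifs <;> linarith) ?_
  · refine le_trans (le_of_eq ?_) (key.trans (le_of_eq ?_))
    · rw [designProb_eq_sum]
      -- The design is transposed: columns are the independent coordinates, and those of `K`
      -- determine the negative tests.
      refine Fintype.sum_equiv (Equiv.piComm fun _ _ => Bool) _ _ fun X => ?_
      change _ = if good (fun i => τ i fun t => X t i) then
        ∏ i, rowWeight p (fun t => X t i) *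
          f (fun i => τ i fun t => X t i) i (fun t => X t i) else 0
      simp only [good, τ, columnNegatives_ite]
      by_cases hc : (Finset.univ.filter fun t => ∀ i ∈ K, X t i = false).card ≤ m
      · simp only [hc, true_and, if_true]
        rw [Finset.prod_mul_distrib]
        have hw : ∏ i, rowWeight p (fun t => X t i) = bernoulliWeight p X := by
          unfold rowWeight bernoulliWeight
          exact Finset.prod_comm
        rw [hw]
        have hf : ∀ j, f (fun i => if i ∈ K then some (fun t => X t i) else none) j
            (fun t => X t j)
            = if j ∉ K ∧ j ∈ possibleDefectives X (outcome X K) then 0 else 1 := by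
          intro j
          simp only [f, columnNegatives_ite, mem_possibleDefectives, outcome_eq_false_iff,
            Finset.mem_filter, Finset.mem_univ, true_and]
        rw [Finset.prod_congr rfl fun j _ => hf j]
        by_cases hall : ∀ j ∉ K, j ∉ possibleDefectives X (outcome X K)
        · rw [if_pos hall, Finset.prod_congr rfl fun j _ => if_neg fun hj => hall j hj.1 hj.2]
          simp
        · rw [if_neg hall]
          push Not at hall
          obtain ⟨j, hj⟩ := hall
          have h0 : ∏ j, (if j ∉ K ∧ j ∈ possibleDefectives X (outcome X K)
              then (0 : ℝ) else 1) = 0 := Finset.prod_eq_zero (Finset.mem_univ j) (if_pos hj)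
          rw [h0, mul_zero]
      · simp [hc]
    · simp only [h, ← Finset.sum_mul, sum_rowWeight, one_mul]
      rw [Finset.prod_ite, Finset.prod_const_one, one_mul, Finset.prod_const]
      congr 1
      have : Finset.univ.filter (fun i => i ∉ K) = Kᶜ := by
        ext
        simp
      rw [this, Finset.card_compl, Fintype.card_fin]
  · intro σ hσ i
    by_cases hi : i ∈ K
    · simp [f, h, hi]
    · rcases hσi : σ i with _ | c₀
      · simp only [τ, f, h, hi, if_false, not_false_iff, true_and, Finset.filter_true]
        rw [← Finset.sum_mul, sum_rowWeight, one_mul]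
        have h1 := rowProb_not p fun c : Fin T → Bool => ∀ t ∈ columnNegatives σ, c t = false
        rw [rowProb_none, rowProb_eq_sum] at h1
        refine le_trans (le_of_eq (Eq.trans (Finset.sum_congr rfl fun c _ => ?_) h1))
          (sub_le_sub_left (pow_le_pow_of_le_one hp0 hp1 hσ) 1)
        by_cases hc : ∀ t ∈ columnNegatives σ, c t = false
        · rw [if_pos hc, if_neg (not_not.2 hc), mul_zero]
        · rw [if_neg hc, if_pos hc, mul_one]
      · simp [τ, hi]

/-- Unambiguity requires that no defective is masked, or that more than `m` tests are negative, or
that at most `m` are and yet they rule out every nondefective item. The three subtracted terms bound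
these events. -/
theorem errorProb_ge {A : DetectionAlgorithm} {n k T : ℕ} (hk : k ≤ n) {p : ℝ}
    (hp : p ∈ Set.Icc (0 : ℝ) 1) (m : ℕ) (hpos : 0 < k * (1 - p * (1 - p) ^ (k - 1)) ^ T) :
    (1 - (1 / (k * (1 - p * (1 - p) ^ (k - 1)) ^ T) + (T * (1 - p) ^ k / ((m : ℝ) + 1)
      + (1 - (1 - p) ^ m) ^ (n - k)))) / 2 ≤ errorProb A n k T p := by
  refine errorProb_ge_of_forall hk hp fun K hK => ?_
  have h1 := designProb_not p fun X : Design n T => IsAmbiguous X K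
  have h2 := designProb_no_masked_le (T := T) hp K (by rwa [hK])
  have h3 := designProb_negative_card_gt (T := T) hp K m
  have h4 := designProb_no_nondefective_le (T := T) hp K m
  rw [hK] at h2 h3 h4
  have h5 := designProb_mono hp (E := fun X : Design n T => ¬ IsAmbiguous X K)
    (F := fun X : Design n T => (∀ i ∈ K, ¬ ∀ t, ¬ K.filter (fun l => X t l = true) = {i}) ∨
      (m < (Finset.univ.filter fun t => ∀ i ∈ K, X t i = false).card ∨
      ((Finset.univ.filter fun t => ∀ i ∈ K, X t i = false).card ≤ m ∧
        ∀ j ∉ K, j ∉ possibleDefectives X (outcome X K)))) ?_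
  · have h6 := designProb_or_le hp
      (fun X : Design n T => ∀ i ∈ K, ¬ ∀ t, ¬ K.filter (fun l => X t l = true) = {i})
      (fun X : Design n T => m < (Finset.univ.filter fun t => ∀ i ∈ K, X t i = false).card ∨
      ((Finset.univ.filter fun t => ∀ i ∈ K, X t i = false).card ≤ m ∧
        ∀ j ∉ K, j ∉ possibleDefectives X (outcome X K)))
    have h7 := designProb_or_le hp
      (fun X : Design n T => m < (Finset.univ.filter fun t => ∀ i ∈ K, X t i = false).card)
      (fun X : Design n T => (Finset.univ.filter fun t => ∀ i ∈ K, X t i = false).card ≤ m ∧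
        ∀ j ∉ K, j ∉ possibleDefectives X (outcome X K))
    linarith
  · intro X hX
    by_contra hcon
    rw [not_or, not_or] at hcon
    obtain ⟨hmask, hneg, hnon⟩ := hcon
    simp only [not_forall, not_not, exists_prop] at hmask
    obtain ⟨i, hi, hmi⟩ := hmask
    refine hnon ⟨not_lt.1 hneg, fun j hj hjp => hX (isAmbiguous_of_masked hi hj ?_ hjp)⟩
    simpa using hmi

/-! ### Binomial coefficients and logarithms in the sparse regime. -/

theorem div_pow_le_choose {n k : ℕ} (hkn : k ≤ n) : ((n : ℝ) / k) ^ k ≤ n.choose k := by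
  induction k generalizing n with
  | zero => simp
  | succ k ih =>
    obtain ⟨n, rfl⟩ : ∃ m, n = m + 1 := ⟨n - 1, by omega⟩
    have hkn' : k ≤ n := by omega
    have hc : ((n + 1).choose (k + 1) : ℝ) = ((n : ℝ) + 1) / (k + 1) * n.choose k := by
      have := Nat.add_one_mul_choose_eq n k
      rw [div_mul_eq_mul_div, eq_div_iff (by positivity)]
      exact_mod_cast this.symm
    rw [hc, pow_succ']
    push_cast
    refine mul_le_mul_of_nonneg_left (le_trans ?_ (ih hkn')) (by positivity)
    rcases Nat.eq_zero_or_pos k with rfl | hk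
    · simp
    · have hk' : (0 : ℝ) < k := by exact_mod_cast hk
      have : (k : ℝ) ≤ n := by exact_mod_cast hkn'
      refine pow_le_pow_left₀ (by positivity) ?_ k
      rw [div_le_div_iff₀ (by positivity) hk']
      nlinarith

theorem choose_le_pow_mul_exp {n k : ℕ} (hk : 0 < k) :
    (n.choose k : ℝ) ≤ ((n : ℝ) / k) ^ k * Real.exp k := by
  have hk' : (0 : ℝ) < k := by exact_mod_cast hk
  refine (Nat.choose_le_pow_div k n).trans ?_
  have h := Real.pow_div_factorial_le_exp k hk'.le k
  calc (n : ℝ) ^ k / k.factorial = ((n : ℝ) / k) ^ k * ((k : ℝ) ^ k / k.factorial) := by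
        rw [div_pow]
        field_simp
    _ ≤ _ := by gcongr

namespace HasSparsity

variable {θ : ℝ} {k : ℕ → ℕ}

theorem exists_bounds (h : HasSparsity θ k) : ∃ c C : ℝ, 0 < c ∧ 0 < C ∧
    ∀ᶠ n : ℕ in atTop, c * (n : ℝ) ^ θ ≤ k n ∧ (k n : ℝ) ≤ C * (n : ℝ) ^ θ := by
  obtain ⟨C, hC, h1⟩ := h.1.exists_pos
  obtain ⟨c, hc, h2⟩ := h.2.exists_pos
  refine ⟨c⁻¹, C, by positivity, hC, ?_⟩
  filter_upwards [h1.bound, h2.bound] with n hn1 hn2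
  have : (0 : ℝ) ≤ (n : ℝ) ^ θ := by positivity
  simp only [Real.norm_eq_abs, Nat.abs_cast, abs_of_nonneg this] at hn1 hn2
  refine ⟨?_, hn1⟩
  rw [inv_mul_le_iff₀ hc]
  exact hn2

theorem tendsto_atTop (h : HasSparsity θ k) (hθ : 0 < θ) :
    Tendsto (fun n => (k n : ℝ)) atTop atTop := by
  obtain ⟨c, C, hc, hC, hb⟩ := h.exists_bounds
  refine tendsto_atTop_mono' atTop (hb.mono fun n hn => hn.1) ?_
  exact ((tendsto_rpow_atTop hθ).comp tendsto_natCast_atTop_atTop).const_mul_atTop hc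

theorem tendsto_div (h : HasSparsity θ k) (hθ : θ < 1) :
    Tendsto (fun n => (k n : ℝ) / n) atTop (𝓝 0) := by
  obtain ⟨c, C, hc, hC, hb⟩ := h.exists_bounds
  have h0 : Tendsto (fun n : ℕ => C * (n : ℝ) ^ (-(1 - θ))) atTop (𝓝 0) := by
    simpa using ((tendsto_rpow_neg_atTop (sub_pos.2 hθ)).comp
      tendsto_natCast_atTop_atTop).const_mul C
  refine squeeze_zero' (Eventually.of_forall fun n => by positivity) ?_ h0
  filter_upwards [hb, eventually_gt_atTop 0] with n hn hpos
  have hn' : (0 : ℝ) < n := by exact_mod_cast hpos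
  rw [neg_sub, Real.rpow_sub_one hn'.ne', ← mul_div_assoc]
  gcongr
  exact hn.2

theorem tendsto_log_natCast : Tendsto (fun n : ℕ => Real.log n) atTop atTop :=
  Real.tendsto_log_atTop.comp tendsto_natCast_atTop_atTop

theorem tendsto_log_div_log (h : HasSparsity θ k) (hθ : 0 < θ) :
    Tendsto (fun n => Real.log (k n) / Real.log n) atTop (𝓝 θ) := by
  obtain ⟨c, C, hc, hC, hb⟩ := h.exists_bounds
  have hlim : ∀ a : ℝ, Tendsto (fun n : ℕ => a / Real.log n + θ) atTop (𝓝 θ) := by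
    intro a
    simpa using (tendsto_log_natCast.const_div_atTop a).add_const θ
  refine tendsto_of_tendsto_of_tendsto_of_le_of_le' (hlim (Real.log c)) (hlim (Real.log C)) ?_ ?_
  all_goals
    filter_upwards [hb, eventually_gt_atTop 1,
      (h.tendsto_atTop hθ).eventually_gt_atTop 0] with n hn h1 hk
    have hn0 : (0 : ℝ) < n := by
      have : 0 < n := by omega
      exact_mod_cast this
    have hl : 0 < Real.log n := Real.log_pos (by exact_mod_cast h1)
    have hpow : (0 : ℝ) < (n : ℝ) ^ θ := by positivity
  · rw [div_add' _ _ _ hl.ne']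
    gcongr
    rw [← Real.log_rpow hn0, ← Real.log_mul hc.ne' hpow.ne']
    exact Real.log_le_log (by positivity) hn.1
  · rw [div_add' _ _ _ hl.ne']
    gcongr
    rw [← Real.log_rpow hn0, ← Real.log_mul hC.ne' hpow.ne']
    exact Real.log_le_log hk hn.2

theorem eventually_two_mul_le (h : HasSparsity θ k) (hθ : θ < 1) :
    ∀ᶠ n in atTop, 2 * (k n : ℝ) ≤ n := by
  filter_upwards [(h.tendsto_div hθ).eventually_lt_const (show (0 : ℝ) < 1 / 2 by norm_num),
    eventually_gt_atTop 0] with n hn h0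
  have h0' : (0 : ℝ) < n := by exact_mod_cast h0
  rw [div_lt_iff₀ h0'] at hn
  linarith

/-- The bounds `(n / k) ^ k` and `(n / k) ^ k * exp k` have logarithms that differ by `k`, which is
negligible against `k log n`. -/
theorem tendsto_log_choose (h : HasSparsity θ k) (hθ₀ : 0 < θ) (hθ₁ : θ < 1) :
    Tendsto (fun n : ℕ => Real.log (n.choose (k n)) / (k n * Real.log n)) atTop (𝓝 (1 - θ)) := by
  have h1 : Tendsto (fun n : ℕ => 1 - Real.log (k n) / Real.log n) atTop (𝓝 (1 - θ)) :=
    (h.tendsto_log_div_log hθ₀).const_sub 1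
  have h2 : Tendsto (fun n : ℕ => 1 - Real.log (k n) / Real.log n + 1 / Real.log n) atTop
      (𝓝 (1 - θ)) := by
    simpa using h1.add (tendsto_log_natCast.const_div_atTop 1)
  refine tendsto_of_tendsto_of_tendsto_of_le_of_le' h1 h2 ?_ ?_
  all_goals
    filter_upwards [eventually_gt_atTop 1, (h.tendsto_atTop hθ₀).eventually_gt_atTop 0,
      h.eventually_two_mul_le hθ₁] with n hn hk hkn
    have hkN : 0 < k n := by exact_mod_cast hk
    have hkn' : k n ≤ n := by
      have : (k n : ℝ) ≤ n := by linarith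
      exact_mod_cast this
    have hn0 : (0 : ℝ) < n := by linarith
    have hl : 0 < Real.log n := Real.log_pos (by exact_mod_cast hn)
    have hch : (0 : ℝ) < n.choose (k n) := by exact_mod_cast Nat.choose_pos hkn'
  · have := Real.log_le_log (by positivity) (div_pow_le_choose hkn')
    rw [Real.log_pow, Real.log_div hn0.ne' hk.ne'] at this
    rw [le_div_iff₀ (by positivity)]
    refine le_trans (le_of_eq ?_) this
    field_simp
  · have := Real.log_le_log hch (choose_le_pow_mul_exp (n := n) hkN)
    rw [Real.log_mul (by positivity) (by positivity), Real.log_exp, Real.log_pow,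
      Real.log_div hn0.ne' hk.ne'] at this
    rw [div_le_iff₀ (by positivity)]
    refine le_trans this (le_of_eq ?_)
    field_simp

end HasSparsity

theorem hasSparsity_ceil {θ : ℝ} (hθ : 0 < θ) : HasSparsity θ fun n => ⌈(n : ℝ) ^ θ⌉₊ :=
  ((Asymptotics.isEquivalent_nat_ceil (R := ℝ)).comp_tendsto
    ((tendsto_rpow_atTop hθ).comp tendsto_natCast_atTop_atTop)).isTheta

/-! ### The rate of DD. -/

theorem exp_neg_le_one_sub_inv_pow {k : ℕ} (hk : 2 ≤ k) :
    Real.exp (-1) ≤ (1 - 1 / (k : ℝ)) ^ (k - 1) := by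
  have hk' : (2 : ℝ) ≤ k := by exact_mod_cast hk
  have hpos : (0 : ℝ) < 1 - 1 / k := by
    rw [sub_pos, div_lt_one (by linarith)]
    linarith
  rw [← Real.exp_log (pow_pos hpos (k - 1)), Real.exp_le_exp, Real.log_pow,
    Nat.cast_sub (by omega), Nat.cast_one]
  have h1 := Real.one_sub_inv_le_log_of_pos hpos
  have h2 : 1 - (1 - 1 / (k : ℝ))⁻¹ = -1 / (k - 1) := by
    have : (k : ℝ) - 1 ≠ 0 := by linarith
    have h3 : 1 - 1 / (k : ℝ) = (k - 1) / k := by field_simp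
    rw [h3, inv_div]
    field_simp
    ring
  rw [h2] at h1
  have h3 : (0 : ℝ) < k - 1 := by linarith
  calc (-1 : ℝ) = (k - 1) * (-1 / (k - 1)) := by field_simp
    _ ≤ _ := mul_le_mul_of_nonneg_left h1 h3.le

/-- The error probability of DD with `T ≥ τ k log n` tests and `p = 1 / k`. -/
theorem errorProb_DD_le_rpow {n k T : ℕ} {γ τ : ℝ} (hk : 2 ≤ k) (hγ₀ : 0 < γ) (hγ₁ : γ < 1)
    (hγk : 1 ≤ γ * k) (hkn : 2 * k ≤ n) (hτ : τ * (k * Real.log n) ≤ T) :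
    errorProb DD n k T (1 / k) ≤
      n * (n : ℝ) ^ (-((1 - γ) * τ * Real.exp (-1))) / (γ * k)
        + k * (n : ℝ) ^ (-((1 - γ) * τ * Real.exp (-1))) := by
  have hk0 : (0 : ℝ) < k := by
    have : 0 < k := by omega
    exact_mod_cast this
  have hn0 : (0 : ℝ) < n := by
    have : 0 < n := by omega
    exact_mod_cast this
  set p : ℝ := 1 / k with hpdef
  have hp0 : 0 < p := by positivity
  have hp1 : p ≤ 1 / 2 := by
    rw [hpdef]
    gcongr
    exact_mod_cast hk
  have hp : p ∈ Set.Icc (0 : ℝ) 1 := ⟨hp0.le, by linarith⟩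
  have hpγ : p ≤ γ := by
    rw [hpdef, div_le_iff₀ hk0]
    exact hγk
  set g := ⌊γ * k⌋₊ with hg
  have hgle : (g : ℝ) ≤ γ * k := Nat.floor_le (by positivity)
  have hglt : γ * k < g + 1 := Nat.lt_floor_add_one _
  have hgk : k + g ≤ n := by
    have : (g : ℝ) ≤ k := by nlinarith
    have : g ≤ k := by exact_mod_cast this
    omega
  have hbase := exp_neg_le_one_sub_inv_pow hk
  rw [← hpdef] at hbase
  -- One lower bound on the per-test probability `s` serves both terms: the loss `1 - γ` covers the
  -- extra factor `1 - p` in the first and `(1 - p) ^ g` in the second.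
  have hexp : ∀ s : ℝ, p * ((1 - γ) * Real.exp (-1)) ≤ s → s ≤ 1 →
      (1 - s) ^ T ≤ (n : ℝ) ^ (-((1 - γ) * τ * Real.exp (-1))) := by
    intro s hs hs1
    calc (1 - s) ^ T ≤ Real.exp (-s) ^ T :=
          pow_le_pow_left₀ (by linarith) (Real.one_sub_le_exp_neg s) T
      _ = Real.exp (-(s * T)) := by
          rw [← Real.exp_nat_mul]
          ring_nf
      _ ≤ Real.exp (Real.log n * -((1 - γ) * τ * Real.exp (-1))) := by
          rw [Real.exp_le_exp, mul_neg, neg_le_neg_iff]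
          calc Real.log n * ((1 - γ) * τ * Real.exp (-1))
              = p * ((1 - γ) * Real.exp (-1)) * (τ * (k * Real.log n)) := by
                rw [hpdef]
                field_simp
            _ ≤ p * ((1 - γ) * Real.exp (-1)) * T := by
                have : 0 < 1 - γ := by linarith
                gcongr
            _ ≤ s * T := by gcongr
      _ = _ := by rw [Real.rpow_def_of_pos hn0]
  have hle1 : ∀ m : ℕ, p * (1 - p) ^ m ≤ 1 := fun m =>
    mul_le_one₀ hp.2 (pow_nonneg (by linarith) m) (pow_le_one₀ (by linarith) (by linarith))
  have h1 : (1 - p * (1 - p) ^ k) ^ T ≤ (n : ℝ) ^ (-((1 - γ) * τ * Real.exp (-1))) := by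
    refine hexp _ ?_ (hle1 k)
    have : (1 - p) ^ k = (1 - p) * (1 - p) ^ (k - 1) := by
      rw [← pow_succ']
      congr 1
      omega
    rw [this]
    gcongr
    linarith
  have h2 : (1 - p * (1 - p) ^ (k + g - 1)) ^ T ≤ (n : ℝ) ^ (-((1 - γ) * τ * Real.exp (-1))) := by
    refine hexp _ ?_ (hle1 _)
    have : (1 - p) ^ (k + g - 1) = (1 - p) ^ g * (1 - p) ^ (k - 1) := by
      rw [← pow_add]
      congr 1
      omega
    rw [this]
    have hbern := one_add_mul_le_pow (a := -p) (by linarith) g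
    have hgp : g * p ≤ γ := by
      rw [hpdef, mul_one_div, div_le_iff₀ hk0]
      exact hgle
    have : 1 - γ ≤ (1 - p) ^ g := by
      rw [← sub_eq_add_neg] at hbern
      linarith
    have hg0 : 0 ≤ (1 - p) ^ g := pow_nonneg (by linarith) g
    gcongr
  refine (errorProb_DD_le hp hgk).trans (add_le_add ?_ ?_)
  · refine div_le_div₀ (by positivity) ?_ (by positivity) hglt.le
    refine mul_le_mul ?_ h1 (pow_nonneg (by linarith [hle1 k]) T) (by positivity)
    exact_mod_cast Nat.sub_le n k
  · gcongr

theorem isAchievableAlong_DD {θ : ℝ} (hθ₀ : 0 < θ) (hθ₁ : θ < 1) {k : ℕ → ℕ}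
    (hk : HasSparsity θ k) {R : ℝ} (h1 : R < Real.exp (-1) / Real.log 2)
    (h2 : R < Real.exp (-1) / Real.log 2 * ((1 - θ) / θ)) : IsAchievableAlong k DD R := by
  have hlog2 : 0 < Real.log 2 := Real.log_pos one_lt_two
  have hθ' : 0 < 1 - θ := by linarith
  have he := Real.exp_pos (-1)
  -- Designing for a slightly larger rate `R'` makes the rate inequality strict, and `R' > 0` allows
  -- division when `R` is not positive.
  obtain ⟨R', hRR', hR'⟩ : ∃ R', max R 0 < R' ∧ R' < min (Real.exp (-1) / Real.log 2)
      (Real.exp (-1) / Real.log 2 * ((1 - θ) / θ)) := by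
    refine exists_between (max_lt (lt_min h1 h2) (lt_min ?_ ?_)) <;> positivity
  obtain ⟨hR, hR0⟩ := max_lt_iff.1 hRR'
  obtain ⟨hR1, hR2⟩ := lt_min_iff.1 hR'
  rw [lt_div_iff₀ hlog2] at hR1
  rw [div_mul_div_comm, lt_div_iff₀ (by positivity)] at hR2
  -- The limit of `T / (k log n)` at rate `R'`. A `τ` just below it leaves room for the limit, and
  -- `β < 1` for the intruders.
  set τ₁ : ℝ := (1 - θ) / (R' * Real.log 2) with hτ₁
  have hτ : max θ (1 - θ) / Real.exp (-1) < τ₁ := by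
    rw [div_lt_iff₀ he, hτ₁, div_mul_eq_mul_div, lt_div_iff₀ (by positivity)]
    rcases max_cases θ (1 - θ) with ⟨h, -⟩ | ⟨h, -⟩ <;> rw [h] <;> nlinarith
  obtain ⟨τ, hτa, hτb⟩ := exists_between hτ
  have hm0 : 0 < max θ (1 - θ) := lt_max_of_lt_left hθ₀
  have hτ0 : 0 < τ := lt_trans (by positivity) hτa
  rw [div_lt_iff₀ he] at hτa
  obtain ⟨β, hβa, hβb⟩ := exists_between ((div_lt_one (by positivity)).2 hτa)
  have hβ0 : 0 < β := lt_trans (by positivity) hβa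
  set γ := 1 - β with hγ
  rw [div_lt_iff₀ (by positivity)] at hβa
  set b := (1 - γ) * τ * Real.exp (-1) with hb
  have hbβ : b = β * (τ * Real.exp (-1)) := by
    rw [hb, hγ]
    ring
  rw [← hbβ] at hβa
  have hbθ : θ < b := (le_max_left _ _).trans_lt hβa
  have hbθ' : 1 - θ < b := (le_max_right _ _).trans_lt hβa
  obtain ⟨c, C, hc, hC, hbounds⟩ := hk.exists_bounds
  have hγ0 : 0 < γ := by linarith
  have hlim : Tendsto (fun n : ℕ => (γ * c)⁻¹ * (n : ℝ) ^ (-(b - (1 - θ)))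
      + C * (n : ℝ) ^ (-(b - θ))) atTop (𝓝 0) := by
    simpa using (((tendsto_rpow_neg_atTop (sub_pos.2 hbθ')).comp
      tendsto_natCast_atTop_atTop).const_mul (γ * c)⁻¹).add
      (((tendsto_rpow_neg_atTop (sub_pos.2 hbθ)).comp tendsto_natCast_atTop_atTop).const_mul C)
  -- The subtracted term absorbs the loss from rounding `T` down.
  have hT : Tendsto (fun n : ℕ => Real.log (n.choose (k n)) / (k n * Real.log n) /
      (R' * Real.log 2) - 1 / (k n * Real.log n)) atTop (𝓝 τ₁) := by
    have h3 := ((hk.tendsto_atTop hθ₀).atTop_mul_atTop₀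
      HasSparsity.tendsto_log_natCast).const_div_atTop 1
    simpa using ((hk.tendsto_log_choose hθ₀ hθ₁).div_const (R' * Real.log 2)).sub h3
  intro ε hε
  filter_upwards [hlim.eventually_lt_const hε, hT.eventually_const_lt hτb, hbounds,
    hk.eventually_two_mul_le hθ₁, (hk.tendsto_atTop hθ₀).eventually_ge_atTop 2,
    (hk.tendsto_atTop hθ₀).eventually_ge_atTop (1 / γ), eventually_gt_atTop 1]
    with n hn1 hn2 hn3 hn4 hn5 hn6 hn7
  have hn0 : (0 : ℝ) < n := by linarith
  have hk0 : (0 : ℝ) < k n := by linarith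
  have hl : 0 < Real.log n := Real.log_pos (by exact_mod_cast hn7)
  have hk2 : 2 ≤ k n := by exact_mod_cast hn5
  set T := ⌊Real.log (n.choose (k n)) / (R' * Real.log 2)⌋₊ with hTdef
  have hTlow : τ * (k n * Real.log n) ≤ T := by
    have h3 := Nat.lt_floor_add_one (Real.log (n.choose (k n)) / (R' * Real.log 2))
    rw [← hTdef] at h3
    have h4 : Real.log (n.choose (k n)) / (k n * Real.log n) / (R' * Real.log 2)
        - 1 / (k n * Real.log n)
        = (Real.log (n.choose (k n)) / (R' * Real.log 2) - 1) / (k n * Real.log n) := by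
      rw [sub_div, div_right_comm]
    rw [h4, lt_div_iff₀ (by positivity)] at hn2
    linarith
  have hTpos : (0 : ℝ) < T := lt_of_lt_of_le (by positivity) hTlow
  have hTup : (T : ℝ) ≤ Real.log (n.choose (k n)) / (R' * Real.log 2) :=
    Nat.floor_le (div_nonneg (Real.log_natCast_nonneg _) (by positivity))
  refine ⟨1 / k n, ⟨by positivity, by rw [div_le_one hk0]; linarith⟩, T,
    by exact_mod_cast hTpos, ?_, ?_⟩
  · refine hR.trans_le ?_
    rw [Real.logb, le_div_iff₀ hTpos, le_div_iff₀ hlog2]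
    rw [le_div_iff₀ (by positivity)] at hTup
    linarith
  · refine lt_of_le_of_lt (errorProb_DD_le_rpow hk2 hγ0 (by linarith) ?_ ?_ hTlow)
      (lt_of_le_of_lt ?_ hn1)
    · rwa [div_le_iff₀' hγ0] at hn6
    · exact_mod_cast hn4
    · rw [← hb]
      have hnb : (0 : ℝ) < (n : ℝ) ^ (-b) := by positivity
      refine add_le_add ?_ ?_
      · have : (n : ℝ) * (n : ℝ) ^ (-b) / (γ * (c * (n : ℝ) ^ θ))
            = (γ * c)⁻¹ * (n : ℝ) ^ (-(b - (1 - θ))) := by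
          rw [show -(b - (1 - θ)) = 1 + -b - θ by ring, Real.rpow_sub hn0, Real.rpow_add hn0,
            Real.rpow_one]
          field_simp
        rw [← this]
        gcongr
        exact hn3.1
      · rw [show -(b - θ) = θ + -b by ring, Real.rpow_add hn0, ← mul_assoc]
        gcongr
        exact hn3.2

/-! ### The asymptotic converse, uniformly in `p`. -/

theorem mul_one_sub_pow_le {p : ℝ} (hp : p ∈ Set.Icc (0 : ℝ) 1) {m : ℕ} (hm : 0 < m) :
    p * (1 - p) ^ m ≤ Real.exp (-1) / m := by
  have hm' : (0 : ℝ) < m := by exact_mod_cast hm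
  rw [le_div_iff₀ hm']
  have h1 : (1 - p) ^ m ≤ Real.exp (-(p * m)) := by
    refine (pow_le_pow_left₀ (by linarith [hp.2]) (Real.one_sub_le_exp_neg p) m).trans
      (le_of_eq ?_)
    rw [← Real.exp_nat_mul]
    ring_nf
  calc p * (1 - p) ^ m * m = p * m * (1 - p) ^ m := by ring
    _ ≤ p * m * Real.exp (-(p * m)) := mul_le_mul_of_nonneg_left h1 (mul_nonneg hp.1 hm'.le)
    _ ≤ _ := Real.mul_exp_neg_le_exp_neg_one _

theorem exp_neg_one_lt_one : Real.exp (-1) < 1 := by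
  simp

/-- A lower bound for the expected number of masked defective items. -/
theorem exp_le_mul_one_sub_pow {p : ℝ} (hp : p ∈ Set.Icc (0 : ℝ) 1) {k T : ℕ} (hk : 2 < k) :
    Real.exp (Real.log k - T * (Real.exp (-1) / (k - 1 - Real.exp (-1))))
      ≤ k * (1 - p * (1 - p) ^ (k - 1)) ^ T := by
  have hk' : (2 : ℝ) < k := by exact_mod_cast hk
  have he := exp_neg_one_lt_one
  have he0 := Real.exp_pos (-1)
  have hq := mul_one_sub_pow_le hp (m := k - 1) (by omega)
  rw [Nat.cast_sub (by omega), Nat.cast_one] at hq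
  have hq1 : Real.exp (-1) / ((k : ℝ) - 1) < 1 := by
    rw [div_lt_one (by linarith)]
    linarith
  have hpos : 0 < 1 - Real.exp (-1) / ((k : ℝ) - 1) := by linarith
  have h1 := Real.one_sub_inv_le_log_of_pos hpos
  have h2 : 1 - (1 - Real.exp (-1) / ((k : ℝ) - 1))⁻¹
      = -(Real.exp (-1) / (k - 1 - Real.exp (-1))) := by
    have h3 : (k : ℝ) - 1 ≠ 0 := by linarith
    have h4 : (k : ℝ) - 1 - Real.exp (-1) ≠ 0 := by linarith
    rw [one_sub_div h3, inv_div]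
    field_simp
    ring
  rw [h2] at h1
  rw [sub_eq_add_neg, Real.exp_add, Real.exp_log (by linarith), ← mul_neg, Real.exp_nat_mul]
  refine mul_le_mul_of_nonneg_left (pow_le_pow_left₀ (Real.exp_pos _).le ?_ T) (by linarith)
  rw [← Real.le_log_iff_exp_le (by linarith)]
  exact h1.trans (Real.log_le_log hpos (by linarith))

/-- A lower bound for the probability that an item avoids slightly more than the expected number of
negative tests. -/
theorem exp_neg_le_one_sub_pow_floor {p : ℝ} (hp : p ∈ Set.Icc (0 : ℝ) 1) {k T : ℕ} (hk : 0 < k)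
    {a : ℝ} (ha : 0 ≤ a) :
    Real.exp (-(a * T * (Real.exp (-1) / k))) ≤ (1 - p) ^ ⌊a * (T * (1 - p) ^ k)⌋₊ := by
  have hk' : (0 : ℝ) < k := by exact_mod_cast hk
  rcases hp.2.eq_or_lt with rfl | hp1
  -- For `p = 1` the logarithm below is unusable, but the floor is zero.
  · have : (1 - (1 : ℝ)) ^ k = 0 := by simp [hk.ne']
    rw [this, mul_zero, mul_zero, Nat.floor_zero, pow_zero, Real.exp_le_one_iff, neg_nonpos]
    positivity
  · have hq : 0 < 1 - p := by linarith
    set u := -Real.log (1 - p) with hu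
    have hu0 : 0 ≤ u := by
      have := Real.log_nonpos hq.le (by linarith [hp.1])
      linarith
    have hpow : ∀ m : ℕ, (1 - p) ^ m = Real.exp (-(u * m)) := by
      intro m
      rw [hu, neg_mul, neg_neg, mul_comm, Real.exp_nat_mul, Real.exp_log hq]
    have hfl : (⌊a * (T * (1 - p) ^ k)⌋₊ : ℝ) ≤ a * (T * (1 - p) ^ k) :=
      Nat.floor_le (by positivity)
    rw [hpow ⌊a * (T * (1 - p) ^ k)⌋₊, Real.exp_le_exp, neg_le_neg_iff]
    -- Uniformity in `p`: with `1 - p = exp (-u)`, a denser design hits more items per test but has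
    -- fewer negative tests, and the product is at most `1 / (e k)`.
    have hmax := Real.mul_exp_neg_le_exp_neg_one (u * k)
    rw [← hpow k] at hmax
    calc u * ⌊a * (T * (1 - p) ^ k)⌋₊ ≤ u * (a * (T * (1 - p) ^ k)) := by gcongr
      _ = a * T * (u * k * (1 - p) ^ k / k) := by field_simp
      _ ≤ _ := by gcongr

/-- `errorProb_ge` with `m` equal to `a` times the expected number of negative tests. By `haτ` an
item avoids `m` tests with probability at least `n ^ (-θ)`, and at least `n / 2` nondefective items
are available. -/
theorem errorProb_ge_of_tests_le {A : DetectionAlgorithm} {n k T : ℕ} {p θ τ a : ℝ}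
    (hp : p ∈ Set.Icc (0 : ℝ) 1) (hk : 2 < k) (hkn : 2 * k ≤ n) (ha : 0 < a)
    (haτ : a * (τ * Real.exp (-1)) ≤ θ) (hT : (T : ℝ) ≤ τ * (k * Real.log n)) :
    (1 - (Real.exp (-(Real.log k - τ * (k * Real.log n) *
      (Real.exp (-1) / (k - 1 - Real.exp (-1))))) +
      (1 / a + Real.exp (-(1 / 2 * (n : ℝ) ^ (1 - θ)))))) / 2 ≤ errorProb A n k T p := by
  have hk' : (2 : ℝ) < k := by exact_mod_cast hk
  have hn0 : (0 : ℝ) < n := by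
    have : 0 < n := by omega
    exact_mod_cast this
  have hkn' : 2 * (k : ℝ) ≤ n := by exact_mod_cast hkn
  have he := exp_neg_one_lt_one
  have he0 := Real.exp_pos (-1)
  have hq0 : 0 ≤ 1 - p := by linarith [hp.2]
  have hlog : 0 ≤ Real.log n := Real.log_natCast_nonneg n
  have hW : Real.exp (Real.log k - τ * (k * Real.log n) *
      (Real.exp (-1) / (k - 1 - Real.exp (-1)))) ≤ k * (1 - p * (1 - p) ^ (k - 1)) ^ T := by
    refine le_trans ?_ (exp_le_mul_one_sub_pow (T := T) hp hk)
    rw [Real.exp_le_exp]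
    refine sub_le_sub_left (mul_le_mul_of_nonneg_right hT ?_) _
    exact div_nonneg he0.le (by linarith)
  refine le_trans ?_ (errorProb_ge (A := A) (by omega) hp ⌊a * (T * (1 - p) ^ k)⌋₊
    ((Real.exp_pos _).trans_le hW))
  have h1 : 1 / (k * (1 - p * (1 - p) ^ (k - 1)) ^ T)
      ≤ Real.exp (-(Real.log k - τ * (k * Real.log n) *
      (Real.exp (-1) / (k - 1 - Real.exp (-1))))) := by
    rw [Real.exp_neg, ← one_div]
    exact one_div_le_one_div_of_le (Real.exp_pos _) hW
  have h2 : T * (1 - p) ^ k / ((⌊a * (T * (1 - p) ^ k)⌋₊ : ℝ) + 1) ≤ 1 / a := by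
    rw [div_le_div_iff₀ (by positivity) ha, mul_comm, one_mul]
    exact (Nat.lt_floor_add_one _).le
  have h3 : (1 - (1 - p) ^ ⌊a * (T * (1 - p) ^ k)⌋₊) ^ (n - k)
      ≤ Real.exp (-(1 / 2 * (n : ℝ) ^ (1 - θ))) := by
    have hx := exp_neg_le_one_sub_pow_floor (T := T) hp (show 0 < k by omega) ha.le
    have hx1 : (1 - p) ^ ⌊a * (T * (1 - p) ^ k)⌋₊ ≤ 1 := pow_le_one₀ hq0 (by linarith [hp.1])
    set x := (1 - p) ^ ⌊a * (T * (1 - p) ^ k)⌋₊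
    have hxn : (n : ℝ) ^ (-θ) ≤ x := by
      refine le_trans ?_ hx
      rw [Real.rpow_def_of_pos hn0, Real.exp_le_exp, mul_neg, neg_le_neg_iff]
      calc a * T * (Real.exp (-1) / k) ≤ a * (τ * (k * Real.log n)) * (Real.exp (-1) / k) := by
            gcongr
        _ = Real.log n * (a * (τ * Real.exp (-1))) := by field_simp
        _ ≤ _ := by gcongr
    calc (1 - x) ^ (n - k) ≤ Real.exp (-x) ^ (n - k) :=
          pow_le_pow_left₀ (by linarith) (Real.one_sub_le_exp_neg x) _
      _ = Real.exp (-(((n - k : ℕ) : ℝ) * x)) := by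
          rw [← Real.exp_nat_mul, mul_neg]
      _ ≤ _ := by
          rw [Real.exp_le_exp, neg_le_neg_iff, sub_eq_add_neg, Real.rpow_add hn0, Real.rpow_one,
            Nat.cast_sub (by omega), ← mul_assoc]
          have h4 : 1 / 2 * (n : ℝ) ≤ n - k := by linarith
          exact mul_le_mul h4 hxn (by positivity) (by linarith)
  linarith

theorem tendsto_div_sub_const (a : ℝ) : Tendsto (fun x : ℝ => x / (x - a)) atTop (𝓝 1) := by
  have h : Tendsto (fun x : ℝ => 1 + a / (x - a)) atTop (𝓝 1) := by
    simpa [sub_eq_add_neg] using ((tendsto_atTop_add_const_right atTop (-a) tendsto_id).const_div_atTop a).const_add 1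
  refine h.congr' ?_
  filter_upwards [eventually_gt_atTop a] with x hx
  have : x - a ≠ 0 := by linarith
  field_simp
  ring

theorem rate_le {θ : ℝ} (hθ₀ : 0 < θ) (hθ₁ : θ < 1) {k : ℕ → ℕ} (hk : HasSparsity θ k)
    {B : DetectionAlgorithm} {R : ℝ} (h : IsAchievableAlong k B R) :
    R ≤ Real.exp (-1) / Real.log 2 * ((1 - θ) / θ) := by
  by_contra! hR
  have hlog2 : 0 < Real.log 2 := Real.log_pos one_lt_two
  have hθ' : 0 < 1 - θ := by linarith
  have he := Real.exp_pos (-1)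
  have hR0 : 0 < R := lt_of_le_of_lt (by positivity) hR
  rw [div_mul_div_comm, div_lt_iff₀ (by positivity)] at hR
  set τ₁ : ℝ := (1 - θ) / (R * Real.log 2) with hτ₁
  have hτ₁0 : 0 < τ₁ := by positivity
  have hτ : τ₁ < θ / Real.exp (-1) := by
    rw [lt_div_iff₀ he, hτ₁, div_mul_eq_mul_div, div_lt_iff₀ (by positivity)]
    linarith
  obtain ⟨τ, hτa, hτb⟩ := exists_between hτ
  have hτ0 : 0 < τ := hτ₁0.trans hτa
  rw [lt_div_iff₀ he] at hτb
  -- The largest factor permitted by `haτ`; it exceeds one exactly because `τ / e < θ`, which keeps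
  -- the Markov bound `1 / a` below one.
  set a := θ / (τ * Real.exp (-1)) with ha
  have ha1 : 1 < a := (one_lt_div (by positivity)).2 hτb
  have ha0 : 0 < a := by linarith
  have haτ : a * (τ * Real.exp (-1)) ≤ θ := (div_mul_cancel₀ _ (by positivity)).le
  have hW : Tendsto (fun n => Real.log (k n) - τ * (k n * Real.log n) *
      (Real.exp (-1) / (k n - 1 - Real.exp (-1)))) atTop atTop := by
    have h1 : Tendsto (fun n => Real.log (k n) / Real.log n - τ * Real.exp (-1) *
        (k n / (k n - (1 + Real.exp (-1))))) atTop (𝓝 (θ - τ * Real.exp (-1) * 1)) :=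
      (hk.tendsto_log_div_log hθ₀).sub
        (((tendsto_div_sub_const _).comp (hk.tendsto_atTop hθ₀)).const_mul _)
    refine (h1.pos_mul_atTop (by linarith) HasSparsity.tendsto_log_natCast).congr' ?_
    filter_upwards [HasSparsity.tendsto_log_natCast.eventually_gt_atTop 0] with n hn
    rw [sub_sub, sub_mul, div_mul_cancel₀ _ hn.ne']
    ring
  have hV : Tendsto (fun n : ℕ => 1 / 2 * (n : ℝ) ^ (1 - θ)) atTop atTop :=
    ((tendsto_rpow_atTop hθ').comp tendsto_natCast_atTop_atTop).const_mul_atTop (by norm_num)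
  have hlim := (Real.tendsto_exp_neg_atTop_nhds_zero.comp hW).add
    ((Real.tendsto_exp_neg_atTop_nhds_zero.comp hV).const_add (1 / a))
  rw [zero_add, add_zero] at hlim
  have hinv : 1 / a < 1 := (div_lt_one ha0).2 ha1
  have hT := (hk.tendsto_log_choose hθ₀ hθ₁).div_const (R * Real.log 2)
  -- The error is at least about `(1 - 1 / a) / 2`, so half of that is a level that achievability
  -- cannot reach.
  have hev := ((((hlim.eventually_lt_const
    (show 1 / a < 1 - 2 * ((1 - 1 / a) / 4) by linarith)).and (hT.eventually_lt_const hτa)).and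
    (hk.eventually_two_mul_le hθ₁)).and ((hk.tendsto_atTop hθ₀).eventually_gt_atTop 2)).and
    ((HasSparsity.tendsto_log_natCast.eventually_gt_atTop 0).and
      (h ((1 - 1 / a) / 4) (by linarith)))
  obtain ⟨n, ⟨⟨⟨hn1, hn2⟩, hn3⟩, hn4⟩, hl, p, hp, T, hTpos, hRT, herr⟩ := hev.exists
  have hTpos' : (0 : ℝ) < T := by exact_mod_cast hTpos
  have hk0 : (0 : ℝ) < k n := by linarith
  have hTle : (T : ℝ) ≤ τ * (k n * Real.log n) := by
    rw [Real.logb, lt_div_iff₀ hTpos', lt_div_iff₀ hlog2] at hRT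
    rw [div_lt_iff₀ (by positivity), div_lt_iff₀ (by positivity)] at hn2
    by_contra! hcon
    have := mul_lt_mul_of_pos_right hcon (show 0 < R * Real.log 2 by positivity)
    nlinarith
  have hge := errorProb_ge_of_tests_le (A := B) hp (by exact_mod_cast hn4) (by exact_mod_cast hn3)
    ha0 haτ hTle
  simp only [Function.comp_def] at hn1
  linarith

/-! ### Suprema of rates and the capacity formula. -/

theorem maxRate_le_of_forall {θ b : ℝ} {A : DetectionAlgorithm}
    (h : ∀ R, IsAchievable θ A R → R ≤ b) : maxRate θ A ≤ b :=
  iSup_le fun R => EReal.coe_le_coe_iff.2 (h R.1 R.2)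

theorem le_maxRate_of_forall {θ b : ℝ} {A : DetectionAlgorithm}
    (h : ∀ R, R < b → IsAchievable θ A R) : (b : EReal) ≤ maxRate θ A := by
  refine EReal.ge_of_forall_gt_iff_ge.1 fun R hR => ?_
  exact le_iSup (fun R : {R : ℝ // IsAchievable θ A R} => ((R : ℝ) : EReal))
    ⟨R, h R (EReal.coe_lt_coe_iff.1 hR)⟩

theorem maxRate_mono {θ : ℝ} {A B : DetectionAlgorithm}
    (h : ∀ R, IsAchievable θ A R → IsAchievable θ B R) : maxRate θ A ≤ maxRate θ B :=
  iSup_le fun R => le_iSup (fun R : {R : ℝ // IsAchievable θ B R} => ((R : ℝ) : EReal))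
    ⟨R.1, h R.1 R.2⟩

theorem exp_neg_one_le_binEntropy : Real.exp (-1) ≤ Real.binEntropy (Real.exp (-1)) := by
  have he := Real.exp_pos (-1)
  have h1 := exp_neg_one_lt_one
  have h2 : Real.log (1 - Real.exp (-1)) ≤ 0 := Real.log_nonpos (by linarith) (by linarith)
  rw [Real.binEntropy, Real.log_inv, Real.log_inv, Real.log_exp]
  nlinarith

/-- The second term is proportional to `ν exp (-ν)`, maximal at `ν = 1`. There the entropy term is
no smaller, since one summand of the entropy is already `exp (-1)` and `(1 - θ) / θ ≤ 1`. -/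
theorem isGreatest_capacityObjective {θ : ℝ} (hθ : 1 / 2 ≤ θ) (hθ₁ : θ < 1) :
    IsGreatest (capacityObjective θ '' Set.Ioi 0)
      (Real.exp (-1) / Real.log 2 * ((1 - θ) / θ)) := by
  have hlog2 : 0 < Real.log 2 := Real.log_pos one_lt_two
  have hθ₀ : 0 < θ := by linarith
  have hθ' : 0 ≤ (1 - θ) / θ := div_nonneg (by linarith) hθ₀.le
  have hθ'' : (1 - θ) / θ ≤ 1 := by
    rw [div_le_one hθ₀]
    linarith
  have hform : ∀ ν : ℝ, ν / (Real.exp ν * Real.log 2) = ν * Real.exp (-ν) / Real.log 2 := by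
    intro ν
    rw [Real.exp_neg]
    field_simp
  refine ⟨⟨1, Set.mem_Ioi.2 one_pos, ?_⟩, ?_⟩
  · rw [capacityObjective, hform, one_mul, min_eq_right]
    have h1 : Real.exp (-1) / Real.log 2 * ((1 - θ) / θ) ≤ Real.exp (-1) / Real.log 2 :=
      mul_le_of_le_one_right (by positivity) hθ''
    refine h1.trans ?_
    gcongr
    exact exp_neg_one_le_binEntropy
  · rintro _ ⟨ν, -, rfl⟩
    refine (min_le_right _ _).trans ?_
    rw [hform]
    gcongr
    exact Real.mul_exp_neg_le_exp_neg_one ν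

theorem theorem2 (θ : ℝ) (hθ₀ : 0 < θ) (hθ₁ : θ < 1)
    (A : DetectionAlgorithm) (hA : IsSCOMP A) :
    HasPropertyP A ∧
    (∀ k : ℕ → ℕ, HasSparsity θ k → ∀ R : ℝ, IsAchievableAlong k DD R → IsAchievableAlong k A R) ∧
    (∀ R : ℝ, IsAchievable θ DD R → IsAchievable θ A R) ∧
    maxRate θ DD ≤ maxRate θ A ∧
    ((min (1 / (Real.exp 1 * Real.log 2))
        (1 / (Real.exp 1 * Real.log 2) * ((1 - θ) / θ)) : ℝ) : EReal) ≤ maxRate θ DD ∧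
    (1 / 2 ≤ θ →
      maxRate θ A = capacity θ ∧
      ∃ C : ℝ, IsGreatest (capacityObjective θ '' Set.Ioi 0) C ∧ maxRate θ A = (C : EReal) ∧
        ∀ k : ℕ → ℕ, HasSparsity θ k → ∀ (B : DetectionAlgorithm) (R : ℝ),
          IsAchievableAlong k B R → R ≤ C) := by
  have hP := hA.hasPropertyP
  have hach : ∀ R : ℝ, IsAchievable θ DD R → IsAchievable θ A R := fun R hR k hk =>
    (hR k hk).of_hasPropertyP hP
  have hconst : 1 / (Real.exp 1 * Real.log 2) = Real.exp (-1) / Real.log 2 := by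
    rw [Real.exp_neg, ← div_div, one_div]
  have hDD : ((min (1 / (Real.exp 1 * Real.log 2))
      (1 / (Real.exp 1 * Real.log 2) * ((1 - θ) / θ)) : ℝ) : EReal) ≤ maxRate θ DD := by
    rw [hconst]
    refine le_maxRate_of_forall fun R hR k hk => ?_
    obtain ⟨h1, h2⟩ := lt_min_iff.1 hR
    exact isAchievableAlong_DD hθ₀ hθ₁ hk h1 h2
  refine ⟨hP, fun k _ R hR => hR.of_hasPropertyP hP, hach, maxRate_mono hach, hDD, fun hθ => ?_⟩
  set C := Real.exp (-1) / Real.log 2 * ((1 - θ) / θ) with hC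
  -- An actual sequence of the given sparsity is needed here; otherwise achievability could be
  -- vacuous.
  have hupper : ∀ B, maxRate θ B ≤ C := fun B => maxRate_le_of_forall fun R hR =>
    rate_le hθ₀ hθ₁ (hasSparsity_ceil hθ₀) (hR _ (hasSparsity_ceil hθ₀))
  have hlower : (C : EReal) ≤ maxRate θ A := by
    refine le_trans ?_ (hDD.trans (maxRate_mono hach))
    rw [hconst, min_eq_right]
    refine mul_le_of_le_one_right (div_nonneg (Real.exp_pos _).le (Real.log_pos one_lt_two).le) ?_
    rw [div_le_one hθ₀]
    linarith
  refine ⟨le_antisymm (le_iSup (maxRate θ) A) ((iSup_le hupper).trans hlower), C,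
    isGreatest_capacityObjective hθ hθ₁, le_antisymm (hupper A) hlower, ?_⟩
  exact fun k hk B R hR => rate_le hθ₀ hθ₁ hk hR
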